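/- Two stacks in parallel process the input $1,2,\dots,n$ by operations $I_1,I_2$ (input the next item to stack 1 or 2) and $O_1,O_2$ (output the top item of stack 1 or 2). A permutation of $\{1,\dots,n\}$ is \emph{achievable} if some word of operations that processes the whole input and leaves both stacks empty outputs it. An \emph{operation sequence} is a word on $\{I_1,I_2,O_1,O_2\}$ that contains, for $i=1,2$, as many letters $I_i$ as $O_i$, and in each prefix at least as many $I_i$ as $O_i$. Its $k$th \emph{arch} joins the times at which item $k$ is input and output; it is red if item $k$ goes through stack 1 and blue otherwise. Two arches of different colours joining $i<j$ and $i'<j'$ cross if $i<i'<j<j'$ or $i'<i<j'<j$. An operation sequence is \emph{canonical} if it contains neither $I_1O_2$ nor $I_2O_1$ as a factor and, in each connected component of the graph whose vertices are the arches and whose edges are the crossing pairs, the first arch is red. It is \emph{primitive} if it is non-empty and is not the concatenation of two non-empty operation sequences. A permutation is \emph{primitive} if it is produced by a primitive canonical operation sequence. Let $S(t)$ and $S^\bullet(t)$ be the generating functions of achievable permutations and of primitive achievable permutations, counted by their length. Let $Q(a,u)$ be the generating function of quarter plane loops, that is, of square lattice walks (with steps $\mathsf E,\mathsf N,\mathsf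 W,\mathsf S$) that start and end at $(0,0)$ and stay in $\{x\ge 0,\ y\ge 0\}$, where $u$ counts the half-length and $a$ counts the factors $\mathsf{NW}$ and $\mathsf{ES}$. It is a power series in $u$ whose coefficients are polynomials in $a$. Then $S^\bullet(0)=0$, $$S=\frac{1}{1-S^\bullet}\qquad\text{and}\qquad Q\left(-S^\bullet,\ \frac{t}{(1+S^\bullet)^2}\right)=\frac{1+S^\bullet}{1-S^\bullet}.$$ The second identity characterises $S^\bullet$, and hence $S$, in terms of $Q$: if $F\in\mathbb Q[[t]]$ has constant term different from $1$ and $-1$ and satisfies $$Q\left(-F,\ \frac{t}{(1+F)^2}\right)=\frac{1+F}{1-F},$$ then $F=S^\bullet$, and therefore $\dfrac1{1-F}=S$. -/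

import Mathlib

noncomputable section

namespace TwoStacks

/-! Quarter plane loops and their generating function. -/

/-- The four unit steps of the square lattice: East, North, West, South. -/
inductive Step
  | E | N | W | S
  deriving DecidableEq

instance : Fintype Step :=
  ⟨{Step.E, Step.N, Step.W, Step.S}, fun s => by cases s <;> decide⟩

/-- The displacement vector of a step. -/
def Step.vec : Step → ℤ × ℤ
  | .E => (1, 0)
  | .N => (0, 1)
  | .W => (-1, 0)
  | .S => (0, -1)

/-- The endpoint of the walk that starts at the origin and has the given steps. -/
def endpoint (w : List Step) : ℤ × ℤ := (w.map Step.vec).sum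

/-- A quarter plane walk: it starts at the origin and every point it visits has nonnegative
coordinates. -/
def IsQuarterPlaneWalk (w : List Step) : Prop :=
  ∀ p : List Step, p <+: w → 0 ≤ (endpoint p).1 ∧ 0 ≤ (endpoint p).2

/-- A quarter plane loop: a quarter plane walk that ends at the origin. -/
def IsQuarterPlaneLoop (w : List Step) : Prop :=
  IsQuarterPlaneWalk w ∧ endpoint w = 0

/-- The number of corners of type North-West or East-South, that is, the number of pairs of
consecutive steps that are equal to `NW` or to `ES`. -/
def corners (w : List Step) : ℕ :=
  (w.zip w.tail).countP (fun p => p = (Step.N, Step.W) ∨ p = (Step.E, Step.S))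

open Classical in
/-- The generating function `Q(a, u)` of quarter plane loops, counted by half-length (`u`) and by
`NW` or `ES` corners (`a`), as a power series in `u` whose coefficients are polynomials in `a`. -/
def loopSeries : PowerSeries (Polynomial ℚ) :=
  PowerSeries.mk fun n =>
    ∑ w : Fin (2 * n) → Step with IsQuarterPlaneLoop (List.ofFn w),
      (Polynomial.X : Polynomial ℚ) ^ corners (List.ofFn w)

/-- The substitution `P(A, U) = ∑ n, pₙ(A) Uⁿ` of power series `A`, `U` in `t` into a power series
`P(a, u) = ∑ n, pₙ(a) uⁿ` with polynomial coefficients. It is meant for `U` without constant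
term: then `Uⁿ` is divisible by `tⁿ`, and only the terms with `n ≤ m` contribute to the
coefficient of `tᵐ`. -/
def evalSeries (P : PowerSeries (Polynomial ℚ)) (A U : PowerSeries ℚ) : PowerSeries ℚ :=
  PowerSeries.mk fun m =>
    ∑ n ∈ Finset.range (m + 1),
      PowerSeries.coeff m (Polynomial.aeval A (PowerSeries.coeff n P) * U ^ n)

/-! Two stacks in parallel. -/

/-- The operations: input to stack 1 or 2, output from stack 1 or 2. -/
inductive Op
  | I1 | I2 | O1 | O2
  deriving DecidableEq

/-- A configuration of the machine: the items not yet input (in order), the contents of the two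
stacks (top first), and the sequence of items output so far (in order). -/
structure Config where
  input : List ℕ
  stack1 : List ℕ
  stack2 : List ℕ
  output : List ℕ

/-- Perform one operation; `none` if it is impossible. -/
def Config.step : Config → Op → Option Config
  | ⟨k :: inp, s₁, s₂, out⟩, .I1 => some ⟨inp, k :: s₁, s₂, out⟩
  | ⟨k :: inp, s₁, s₂, out⟩, .I2 => some ⟨inp, s₁, k :: s₂, out⟩
  | ⟨inp, k :: s₁, s₂, out⟩, .O1 => some ⟨inp, s₁, s₂, out ++ [k]⟩
  | ⟨inp, s₁, k :: s₂, out⟩, .O2 => some ⟨inp, s₁, s₂, out ++ [k]⟩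
  | _, _ => none

/-- Perform a word of operations from left to right. -/
def Config.run : Config → List Op → Option Config
  | c, [] => some c
  | c, o :: w => (c.step o).bind fun c' => c'.run w

/-- The initial configuration, with input `1, 2, …, n`. -/
def Config.init (n : ℕ) : Config := ⟨List.range' 1 n, [], [], []⟩

/-- The word `w` produces the permutation `π`: it processes the whole input `1, 2, …, n`, leaves
both stacks empty, and outputs the word `π₁ π₂ … πₙ` (where `Fin n` stands for `{1, …, n}`). -/
def Produces {n : ℕ} (w : List Op) (π : Equiv.Perm (Fin n)) : Prop :=
  (Config.init n).run w = some ⟨[], [], [], List.ofFn fun i => (π i : ℕ) + 1⟩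

/-- A permutation is achievable if some word of operations produces it. -/
def IsAchievable {n : ℕ} (π : Equiv.Perm (Fin n)) : Prop :=
  ∃ w : List Op, Produces w π

/-- Operation sequences: as many inputs as outputs for each stack, and in each prefix at least as
many inputs as outputs for each stack. -/
def IsOperationSequence (w : List Op) : Prop :=
  (w.count .I1 = w.count .O1 ∧ w.count .I2 = w.count .O2) ∧
    ∀ p : List Op, p <+: w → p.count .O1 ≤ p.count .I1 ∧ p.count .O2 ≤ p.count .I2

/-! Arches and canonical sequences. The arches of an operation sequence are identified with the
items `1, …, n` that they move. -/

/-- The number of items processed by an operation sequence (that is, of its arches). -/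
def numItems (w : List Op) : ℕ := w.count .I1 + w.count .I2

/-- The configuration after the first `i` operations of `w`. -/
def configAt (w : List Op) (i : ℕ) : Option Config :=
  (Config.init (numItems w)).run (w.take i)

/-- Item `k` is input to a stack by the operation at position `i` (positions start at `0`). -/
def InputAt (w : List Op) (k i : ℕ) : Prop :=
  ∃ c c' : Config, configAt w i = some c ∧ configAt w (i + 1) = some c' ∧
    k ∈ c.input ∧ k ∉ c'.input

/-- Item `k` is output from a stack by the operation at position `j`. -/
def OutputAt (w : List Op) (k j : ℕ) : Prop :=
  ∃ c c' : Config, configAt w j = some c ∧ configAt w (j + 1) = some c' ∧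
    k ∉ c.output ∧ k ∈ c'.output

/-- The arch of item `k` joins `i` to `j`. -/
def IsArch (w : List Op) (k i j : ℕ) : Prop := InputAt w k i ∧ OutputAt w k j

/-- The arch of item `k` is red: the item is processed by the first stack. -/
def IsRed (w : List Op) (k : ℕ) : Prop := ∃ i, InputAt w k i ∧ w[i]? = some Op.I1

/-- The arch of item `k` is blue: the item is processed by the second stack. -/
def IsBlue (w : List Op) (k : ℕ) : Prop := ∃ i, InputAt w k i ∧ w[i]? = some Op.I2

/-- The arches of items `k` and `l` have different colours, and cross once drawn on the same side
of the line, the arch of `k` starting first. -/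
def Crosses (w : List Op) (k l : ℕ) : Prop :=
  (IsRed w k ∧ IsBlue w l ∨ IsBlue w k ∧ IsRed w l) ∧
    ∃ i j i' j' : ℕ, IsArch w k i j ∧ IsArch w l i' j' ∧ i < i' ∧ i' < j ∧ j < j'

/-- The graph of an operation sequence: arches are adjacent if they cross. (The natural numbers
outside `{1, …, n}` are isolated vertices.) -/
def archGraph (w : List Op) : SimpleGraph ℕ := SimpleGraph.fromRel (Crosses w)

/-- The sequence is standard: the first arch of each connected component is red. -/
def IsStandard (w : List Op) : Prop :=
  ∀ k ∈ Finset.Icc 1 (numItems w), (∀ l, (archGraph w).Reachable k l → k ≤ l) → IsRed w k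

/-- The sequence outputs eagerly: it has neither `I₁ O₂` nor `I₂ O₁` as a factor. -/
def OutputsEagerly (w : List Op) : Prop :=
  ¬ [Op.I1, Op.O2] <:+: w ∧ ¬ [Op.I2, Op.O1] <:+: w

/-- Canonical operation sequences. -/
def IsCanonical (w : List Op) : Prop :=
  IsOperationSequence w ∧ IsStandard w ∧ OutputsEagerly w

/-- Primitive operation sequences: non-empty, and not a concatenation of two non-empty operation
sequences. -/
def IsPrimitive (w : List Op) : Prop :=
  IsOperationSequence w ∧ w ≠ [] ∧
    ∀ u v : List Op, IsOperationSequence u → IsOperationSequence v → w = u ++ v → u = [] ∨ v = []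

/-- Primitive achievable permutations: those produced by a primitive canonical operation
sequence. -/
def IsPrimitivePerm {n : ℕ} (π : Equiv.Perm (Fin n)) : Prop :=
  ∃ w : List Op, IsCanonical w ∧ IsPrimitive w ∧ Produces w π

/-- The generating function `S(t)` of achievable permutations, counted by their length. -/
def achievableSeries : PowerSeries ℚ :=
  PowerSeries.mk fun n => (Nat.card {π : Equiv.Perm (Fin n) // IsAchievable π} : ℚ)

/-- The generating function `S•(t)` of primitive achievable permutations, counted by their
length. -/
def primitiveSeries : PowerSeries ℚ :=
  PowerSeries.mk fun n => (Nat.card {π : Equiv.Perm (Fin n) // IsPrimitivePerm π} : ℚ)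

/-- The equation `Q(-F, t / (1 + F)²) = (1 + F) / (1 - F)` for a power series `F` in `t`. The
quotients are quotients of power series if the constant term of `F` is neither `1` nor `-1`. -/
def LoopEquation (F : PowerSeries ℚ) : Prop :=
  evalSeries loopSeries (-F) (PowerSeries.X * ((1 + F) ^ 2)⁻¹) = (1 + F) * (1 - F)⁻¹

end TwoStacks

end

noncomputable section

namespace TwoStacks

-- Call an operation sequence irreducible if it is non-empty and no non-empty operation sequence
-- factor avoids its first letter. Every non-empty operation sequence arises in exactly one way from
-- an irreducible one, `c`, by inserting a possibly empty operation sequence after each letter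
-- (`exists_flat_of_ne_nil`, `flat_injective_of_irreducible`). A non-empty insertion starts with an
-- input and ends with an output, so it destroys a corner (`I₁O₂` or `I₂O₁`) at its slot and creates
-- none. With weight `a` per corner and `u` per item, a class closed under this decomposition has a
-- series `G` with `G - 1 = ∑ u^|c| (a + G - 1)^p G^q`, where `c` runs over the admissible
-- irreducible sequences, has `|c|` items and `p` corners, and `p + q = 2|c|`
-- (`hasSum_irreducible`).
--
-- The equation is used twice. Reading `I₁, I₂, O₁, O₂` as `E, N, W, S` turns all operation
-- sequences into quarter plane loops, so `G = Q(a, u)`. A sequence is standard iff no operation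
-- sequence factor starts with `I₂` (`isStandard_iff`), a condition compatible with insertion, and
-- eager output means `a = 0`; so `G = S` solves the equation with `u = t` and `c` restricted to
-- start with `I₁`. Exchanging the stacks, the same sum over all irreducible `c` is `2(S - 1)`. Let
-- `s = S•`; then `S(1 - s) = 1`, by splitting off the first primitive factor. For `a = -s` and `G =
-- (1 + s)S` one gets `G - 1 = 2(S - 1)` and `a + G - 1 = (1 + s)(S - 1)`: all `2|c|` slots are
-- scaled by `1 + s`, which `u = t/(1 + s)²` compensates. So `(1 + s)S` solves the equation of
-- `Q(-s, u)`, whose solution is unique (`irreducible_equation_unique`).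
--
-- Counting sequences instead of permutations is legitimate because each achievable permutation has
-- exactly one canonical sequence (`IsAchievable.exists_canonical`, `IsCanonical.eq_of_produces`).
-- That the loop equation determines `F` follows `X`-adically: agreement of two solutions modulo
-- `X^k` forces agreement modulo `X^(k+1)` (`LoopEquation.unique`).

local notation "OS" => IsOperationSequence

/-! Words of operations, colour by colour. -/

/-- The input to the first (`false`) or second (`true`) stack. -/
def inp : Bool → Op
  | false => .I1
  | true => .I2

/-- The output from the first (`false`) or second (`true`) stack. -/
def out : Bool → Op
  | false => .O1
  | true => .O2

theorem op_cases (o : Op) : ∃ b, o = inp b ∨ o = out b := by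
  cases o
  · exact ⟨false, .inl rfl⟩
  · exact ⟨true, .inl rfl⟩
  · exact ⟨false, .inr rfl⟩
  · exact ⟨true, .inr rfl⟩

@[simp] theorem inp_inj {b c : Bool} : inp b = inp c ↔ b = c := by
  cases b <;> cases c <;> simp [inp]

@[simp] theorem out_inj {b c : Bool} : out b = out c ↔ b = c := by
  cases b <;> cases c <;> simp [out]

@[simp] theorem inp_ne_out {b c : Bool} : inp b ≠ out c := by
  cases b <;> cases c <;> simp [inp, out]

@[simp] theorem out_ne_inp {b c : Bool} : out b ≠ inp c := inp_ne_out.symm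

/-- The letters of colour `b` form a Dyck word. -/
def IsDyck (b : Bool) (w : List Op) : Prop :=
  w.count (inp b) = w.count (out b) ∧ ∀ p, p <+: w → p.count (out b) ≤ p.count (inp b)

theorem isOperationSequence_iff {w : List Op} :
    IsOperationSequence w ↔ ∀ b, IsDyck b w := by
  constructor
  · rintro ⟨⟨h1, h2⟩, h⟩ (_ | _)
    · exact ⟨h1, fun p hp => (h p hp).1⟩
    · exact ⟨h2, fun p hp => (h p hp).2⟩
  · intro h
    exact ⟨⟨(h false).1, (h true).1⟩, fun p hp => ⟨(h false).2 p hp, (h true).2 p hp⟩⟩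

theorem prefix_append_cases {p u v : List Op} (h : p <+: u ++ v) :
    p <+: u ∨ ∃ q, p = u ++ q ∧ q <+: v := by
  obtain ⟨t, ht⟩ := h
  rcases List.append_eq_append_iff.1 ht with ⟨a, h1, h2⟩ | ⟨a, h1, h2⟩
  · exact .inl ⟨a, h1.symm⟩
  · exact .inr ⟨a, h1, ⟨t, h2.symm⟩⟩

theorem infix_append_cases {y u v : List Op} (h : y <:+: u ++ v) :
    y <:+: u ∨ y <:+: v ∨ ∃ y₁ y₂, y = y₁ ++ y₂ ∧ y₁ <:+ u ∧ y₂ <+: v := by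
  obtain ⟨x, z, h⟩ := h
  rw [List.append_assoc] at h
  rcases List.append_eq_append_iff.1 h with ⟨a, h1, h2⟩ | ⟨a, h1, h2⟩
  · rcases List.append_eq_append_iff.1 h2 with ⟨c, h3, h4⟩ | ⟨c, h3, h4⟩
    · left
      exact ⟨x, c, by rw [h1, h3, List.append_assoc]⟩
    · exact .inr (.inr ⟨a, c, h3, ⟨x, h1.symm⟩, ⟨z, h4.symm⟩⟩)
  · exact .inr (.inl ⟨a, z, by rw [h2, List.append_assoc]⟩)

theorem IsDyck.nil (b : Bool) : IsDyck b [] := ⟨rfl, by simp⟩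

theorem isDyck_insert {b : Bool} {s : List Op} (hs : IsDyck b s) (x z : List Op) :
    IsDyck b (x ++ s ++ z) ↔ IsDyck b (x ++ z) := by
  have e := hs.1
  constructor
  · rintro ⟨h1, h2⟩
    refine ⟨by simp only [List.count_append] at h1 ⊢; omega, fun p hp => ?_⟩
    rcases prefix_append_cases hp with hp | ⟨q, rfl, hq⟩
    · exact h2 p (hp.trans (by rw [List.append_assoc]; exact List.prefix_append _ _))
    · have := h2 (x ++ s ++ q) ((List.prefix_append_right_inj _).2 hq)
      simp only [List.count_append] at this ⊢
      omega
  · rintro ⟨h1, h2⟩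
    refine ⟨by simp only [List.count_append] at h1 ⊢; omega, fun p hp => ?_⟩
    rcases prefix_append_cases hp with hp | ⟨q, rfl, hq⟩
    · rcases prefix_append_cases hp with hp | ⟨q, rfl, hq⟩
      · exact h2 p (hp.trans (List.prefix_append _ _))
      · have h3 := h2 x (List.prefix_append _ _)
        have h4 := hs.2 q hq
        simp only [List.count_append]
        omega
    · have := h2 (x ++ q) ((List.prefix_append_right_inj _).2 hq)
      simp only [List.count_append] at this ⊢
      omega

/-- As the end of a Dyck word, `y` has no excess of inputs; as the start of another, it has none of
outputs, nor has any of its prefixes. This is what makes overlapping operation sequences manageable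
throughout. -/
theorem IsDyck.overlap {b : Bool} {x y z : List Op} (h1 : IsDyck b (x ++ y))
    (h2 : IsDyck b (y ++ z)) : IsDyck b y := by
  have a1 := h1.1
  have a2 := h1.2 x (List.prefix_append _ _)
  have a3 := h2.2 y (List.prefix_append _ _)
  refine ⟨?_, fun p hp => h2.2 p (hp.trans (List.prefix_append _ _))⟩
  simp only [List.count_append] at a1
  omega

theorem operationSequence_nil : OS [] :=
  isOperationSequence_iff.2 fun _ => .nil _

theorem operationSequence_insert {s : List Op} (hs : OS s) (x z : List Op) :
    OS (x ++ s ++ z) ↔ OS (x ++ z) := by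
  rw [isOperationSequence_iff] at hs
  simp only [isOperationSequence_iff, fun b => isDyck_insert (hs b) x z]

theorem operationSequence_append_left {s : List Op} (hs : OS s) (z : List Op) :
    OS (s ++ z) ↔ OS z := operationSequence_insert hs [] z

theorem operationSequence_append_right {s : List Op} (hs : OS s) (x : List Op) :
    OS (x ++ s) ↔ OS x := by
  simpa using operationSequence_insert hs x []

theorem operationSequence_overlap {x y z : List Op} (h1 : OS (x ++ y)) (h2 : OS (y ++ z)) :
    OS y := by
  rw [isOperationSequence_iff] at *
  exact fun b => (h1 b).overlap (h2 b)

theorem operationSequence_cons {o : Op} {w : List Op} (h : OS (o :: w)) : ∃ b, o = inp b := by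
  obtain ⟨b, rfl | rfl⟩ := op_cases o
  · exact ⟨b, rfl⟩
  · have := (isOperationSequence_iff.1 h b).2 [out b] (by simp)
    simp at this

theorem operationSequence_concat {o : Op} {w : List Op} (h : OS (w ++ [o])) :
    ∃ b, o = out b := by
  obtain ⟨b, rfl | rfl⟩ := op_cases o
  · have h1 := (isOperationSequence_iff.1 h b).2 w (by simp)
    have h2 := (isOperationSequence_iff.1 h b).1
    simp at h2
    omega
  · exact ⟨b, rfl⟩

/-! Decomposition of words into a word without operation sequence factor, and operation sequences
inserted between its letters. -/

/-- No factor of the word is a non-empty operation sequence. -/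
def NoFactor (c : List Op) : Prop := ∀ y, y <:+: c → OS y → y = []

/-- Irreducible operation sequences: no non-empty operation sequence factor avoids the first
letter. -/
def IsIrreducible (c : List Op) : Prop := OS c ∧ c ≠ [] ∧ NoFactor c.tail

/-- Insert after each letter the word attached to it. -/
def flat (L : List (Op × List Op)) : List Op := L.flatMap fun p => p.1 :: p.2

@[simp] theorem flat_nil : flat [] = [] := rfl

@[simp] theorem flat_cons (o : Op) (s : List Op) (L : List (Op × List Op)) :
    flat ((o, s) :: L) = o :: (s ++ flat L) := by simp [flat]

@[simp] theorem flat_append (L M : List (Op × List Op)) : flat (L ++ M) = flat L ++ flat M := by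
  simp [flat]

theorem NoFactor.of_infix {c d : List Op} (h : NoFactor c) (hd : d <:+: c) : NoFactor d :=
  fun y hy => h y (hy.trans hd)

theorem operationSequence_flat {L : List (Op × List Op)} (hL : ∀ p ∈ L, OS p.2)
    (x z : List Op) : OS (x ++ flat L ++ z) ↔ OS (x ++ L.map Prod.fst ++ z) := by
  induction L generalizing x with
  | nil => simp
  | cons p L ih =>
    obtain ⟨o, s⟩ := p
    have h1 := ih (fun p hp => hL p (by simp [hp])) (x ++ [o])
    have h2 := operationSequence_insert (hL (o, s) (by simp)) (x ++ [o]) (flat L ++ z)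
    simp only [flat_cons, List.map_cons, List.append_assoc, List.cons_append, List.nil_append]
      at h1 h2 ⊢
    rw [h2, h1]

theorem prefix_flat {L : List (Op × List Op)} {y : List Op} (h : y <+: flat L) :
    y = [] ∨ ∃ L₁ o s L₂ p, L = L₁ ++ (o, s) :: L₂ ∧ p <+: s ∧ y = flat L₁ ++ o :: p := by
  induction L generalizing y with
  | nil => left; simpa using h
  | cons q L ih =>
    obtain ⟨o, s⟩ := q
    rw [flat_cons, List.prefix_cons_iff] at h
    rcases h with rfl | ⟨t, rfl, ht⟩
    · exact .inl rfl
    right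
    rcases prefix_append_cases ht with ht | ⟨q, rfl, hq⟩
    · exact ⟨[], o, s, L, t, rfl, ht, rfl⟩
    · rcases ih hq with rfl | ⟨L₁, o', s', L₂, p, rfl, hp, rfl⟩
      · exact ⟨[], o, s, L, s, rfl, List.prefix_rfl, by simp⟩
      · exact ⟨(o, s) :: L₁, o', s', L₂, p, rfl, hp, by simp⟩

/-- A non-empty prefix ends with a letter `o` and a part `p` of the insertion after it. By overlap
`p` is an operation sequence; deleting it and the earlier insertions leaves a non-empty operation
sequence prefix of the skeleton. -/
theorem NoFactor.eq_nil_of_prefix_flat {L : List (Op × List Op)} (hL : ∀ p ∈ L, OS p.2)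
    (hN : NoFactor (L.map Prod.fst)) {y : List Op} (hy : OS y) (h : y <+: flat L) : y = [] := by
  rcases prefix_flat h with rfl | ⟨L₁, o, s, L₂, p, rfl, ⟨t, rfl⟩, rfl⟩
  · rfl
  exfalso
  have hp : OS p := operationSequence_overlap (x := flat L₁ ++ [o]) (by simpa using hy)
    (hL (o, p ++ t) (by simp))
  have h1 : OS (flat L₁ ++ [o]) :=
    (operationSequence_append_right hp _).1 (by simpa using hy)
  have h2 := (operationSequence_flat (L := L₁) (fun p hp => hL p (by simp [hp])) [] [o]).1
    (by simpa using h1)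
  have := hN _ ⟨[], L₂.map Prod.fst, by simp⟩ h2
  simp at this

/-- If `s` and `s'` differed, the longer would exceed the shorter by an operation sequence that is a
prefix of the other `flat`, hence empty. Then the first letters agree, and the next slots are
compared in the same way. -/
theorem flat_injective_of_noFactor {L L' : List (Op × List Op)} {s s' : List Op} (hs : OS s)
    (hs' : OS s') (hL : ∀ p ∈ L, OS p.2) (hL' : ∀ p ∈ L', OS p.2)
    (hN : NoFactor (L.map Prod.fst)) (hN' : NoFactor (L'.map Prod.fst))
    (h : s ++ flat L = s' ++ flat L') : s = s' ∧ L = L' := by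
  induction L generalizing s s' L' with
  | nil =>
    have e : s' ++ flat L' = s := by simpa using h.symm
    have h1 : OS (flat L') := (operationSequence_append_left hs' _).1 (e ▸ hs)
    have h2 := hN'.eq_nil_of_prefix_flat hL' h1 List.prefix_rfl
    cases L' with
    | nil => simpa using h
    | cons p L' => simp [flat] at h2
  | cons p L ih =>
    obtain ⟨o, t⟩ := p
    have key : s = s' ∧ flat ((o, t) :: L) = flat L' := by
      rcases List.append_eq_append_iff.1 h with ⟨y, h1, h2⟩ | ⟨y, h1, h2⟩
      · have hy : OS y := (operationSequence_append_left hs y).1 (h1 ▸ hs')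
        have := hN.eq_nil_of_prefix_flat hL hy ⟨_, h2.symm⟩
        subst this
        exact ⟨by simpa using h1.symm, h2⟩
      · have hy : OS y := (operationSequence_append_left hs' y).1 (h1 ▸ hs)
        have := hN'.eq_nil_of_prefix_flat hL' hy ⟨_, h2.symm⟩
        subst this
        exact ⟨by simpa using h1, h2.symm⟩
    obtain ⟨rfl, h2⟩ := key
    cases L' with
    | nil => simp at h2
    | cons p' L' =>
      obtain ⟨o', t'⟩ := p'
      simp only [flat_cons, List.cons.injEq] at h2
      obtain ⟨rfl, h2⟩ := h2
      obtain ⟨rfl, rfl⟩ := ih (hL (o, t) (by simp)) (hL' (o, t') (by simp))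
        (fun p hp => hL p (by simp [hp])) (fun p hp => hL' p (by simp [hp]))
        (hN.of_infix (by simpa using (List.suffix_cons _ _).isInfix))
        (hN'.of_infix (by simpa using (List.suffix_cons _ _).isInfix)) h2
      exact ⟨rfl, rfl⟩

/-- The word is read from right to left, keeping a leading operation sequence `s` and a skeleton
without factor. -/
theorem exists_flat_of_noFactor (r : List Op) :
    ∃ s L, OS s ∧ (∀ p ∈ L, OS p.2) ∧ NoFactor (L.map Prod.fst) ∧ r = s ++ flat L := by
  induction r with
  | nil =>
    refine ⟨[], [], operationSequence_nil, by simp, ?_, rfl⟩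
    intro y hy _
    simpa using hy
  | cons o r ih =>
    obtain ⟨s, L, hs, hL, hN, rfl⟩ := ih
    -- If the new letter keeps the skeleton free of factors, `s` becomes its slot. Otherwise a
    -- factor appears that must start at the new letter, and it is absorbed with its insertions into
    -- the leading operation sequence.
    by_cases h : NoFactor (o :: L.map Prod.fst)
    · refine ⟨[], (o, s) :: L, operationSequence_nil, ?_, by simpa using h, by simp⟩
      simp only [List.mem_cons]
      rintro p (rfl | hp)
      exacts [hs, hL p hp]
    · unfold NoFactor at h
      push Not at h
      obtain ⟨y, hy, hyO, hne⟩ := h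
      rcases List.infix_cons_iff.1 hy with hy | hy
      · rcases List.prefix_cons_iff.1 hy with rfl | ⟨t, rfl, u, ht⟩
        · exact absurd rfl hne
        obtain ⟨L₁, L₂, rfl, rfl, rfl⟩ := List.map_eq_append_iff.1 ht.symm
        have hL1 : ∀ p ∈ (o, s) :: L₁, OS p.2 := by
          simp only [List.mem_cons]
          rintro p (rfl | hp)
          exacts [hs, hL p (by simp [hp])]
        refine ⟨flat ((o, s) :: L₁), L₂, ?_, fun p hp => hL p (by simp [hp]), ?_, by simp⟩
        · simpa using (operationSequence_flat hL1 [] []).2 (by simpa using hyO)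
        · exact hN.of_infix (by simpa using (List.suffix_append _ _).isInfix)
      · exact absurd (hN y hy hyO) hne

theorem exists_flat_of_ne_nil {w : List Op} (hw : OS w) (hne : w ≠ []) :
    ∃ L, IsIrreducible (L.map Prod.fst) ∧ (∀ p ∈ L, OS p.2) ∧ flat L = w := by
  obtain ⟨o, r, rfl⟩ := List.exists_cons_of_ne_nil hne
  obtain ⟨s, L, hs, hL, hN, rfl⟩ := exists_flat_of_noFactor r
  have hL1 : ∀ p ∈ (o, s) :: L, OS p.2 := by
    simp only [List.mem_cons]
    rintro p (rfl | hp)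
    exacts [hs, hL p hp]
  refine ⟨(o, s) :: L, ⟨?_, by simp, by simpa using hN⟩, hL1, by simp⟩
  simpa using (operationSequence_flat hL1 [] []).1 (by simpa using hw)

theorem flat_injective_of_irreducible {L L' : List (Op × List Op)}
    (hc : IsIrreducible (L.map Prod.fst)) (hc' : IsIrreducible (L'.map Prod.fst))
    (hL : ∀ p ∈ L, OS p.2) (hL' : ∀ p ∈ L', OS p.2) (h : flat L = flat L') : L = L' := by
  cases L with
  | nil => exact absurd rfl hc.2.1
  | cons p L =>
    cases L' with
    | nil => exact absurd rfl hc'.2.1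
    | cons p' L' =>
      obtain ⟨o, t⟩ := p
      obtain ⟨o', t'⟩ := p'
      simp only [flat_cons, List.cons.injEq] at h
      obtain ⟨rfl, h⟩ := h
      obtain ⟨rfl, rfl⟩ := flat_injective_of_noFactor (hL (o, t) (by simp))
        (hL' (o, t') (by simp)) (fun p hp => hL p (by simp [hp]))
        (fun p hp => hL' p (by simp [hp])) hc.2.2 hc'.2.2 h
      rfl

theorem operationSequence_flat_of_irreducible {L : List (Op × List Op)}
    (hc : IsIrreducible (L.map Prod.fst)) (hL : ∀ p ∈ L, OS p.2) : OS (flat L) := by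
  simpa using (operationSequence_flat hL [] []).2 (by simpa using hc.1)

/-! Standard sequences, in terms of factors. -/

/-- No operation sequence factor starts with an input to the second stack. -/
def FactorStandard (w : List Op) : Prop := ∀ y, y <:+: w → OS y → y.head? ≠ some .I2

theorem FactorStandard.of_infix {c d : List Op} (h : FactorStandard c) (hd : d <:+: c) :
    FactorStandard d :=
  fun y hy => h y (hy.trans hd)

/-- An operation sequence factor that straddles the boundary meets `s` in an operation sequence, by
overlap; the rest is an operation sequence prefix of `flat L`, hence empty. So every such factor
lies in one of the inserted words. -/
theorem FactorStandard.append_flat {L : List (Op × List Op)} {s : List Op} (hs : OS s)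
    (hsS : FactorStandard s) (hL : ∀ p ∈ L, OS p.2) (hLS : ∀ p ∈ L, FactorStandard p.2)
    (hN : NoFactor (L.map Prod.fst)) : FactorStandard (s ++ flat L) := by
  induction L generalizing s with
  | nil => simpa using hsS
  | cons p L ih =>
    obtain ⟨o, t⟩ := p
    have ih' := ih (hL (o, t) (by simp)) (hLS (o, t) (by simp)) (fun p hp => hL p (by simp [hp]))
      (fun p hp => hLS p (by simp [hp]))
      (hN.of_infix (by simpa using (List.suffix_cons _ _).isInfix))
    intro y hy hyO
    rcases infix_append_cases hy with hy | hy | ⟨y₁, y₂, rfl, ⟨x, hx⟩, hy2⟩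
    · exact hsS y hy hyO
    · rw [flat_cons, List.infix_cons_iff] at hy
      rcases hy with hy | hy
      · rw [← flat_cons] at hy
        rw [hN.eq_nil_of_prefix_flat hL hyO hy]
        simp
      · exact ih' y hy hyO
    · have h1 : OS y₁ := operationSequence_overlap (x := x) (hx ▸ hs) hyO
      have h2 := (operationSequence_append_left h1 y₂).1 hyO
      rw [hN.eq_nil_of_prefix_flat hL h2 hy2, List.append_nil]
      exact hsS y₁ ⟨x, [], by simpa using hx⟩ h1

theorem infix_flat {L : List (Op × List Op)} {p : Op × List Op} (hp : p ∈ L) :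
    p.2 <:+: flat L := by
  obtain ⟨L₁, L₂, rfl⟩ := List.append_of_mem hp
  exact ⟨flat L₁ ++ [p.1], flat L₂, by obtain ⟨o, s⟩ := p; simp⟩

theorem factorStandard_flat {L : List (Op × List Op)} (hc : IsIrreducible (L.map Prod.fst))
    (hL : ∀ p ∈ L, OS p.2) : FactorStandard (flat L) ↔
      (L.map Prod.fst).head? = some .I1 ∧ ∀ p ∈ L, FactorStandard p.2 := by
  constructor
  · intro h
    refine ⟨?_, fun p hp => h.of_infix (infix_flat hp)⟩
    have h1 := h _ List.infix_rfl (operationSequence_flat_of_irreducible hc hL)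
    cases L with
    | nil => exact absurd rfl hc.2.1
    | cons p L =>
      obtain ⟨o, t⟩ := p
      obtain ⟨b, rfl⟩ := operationSequence_cons (w := L.map Prod.fst) (by simpa using hc.1)
      cases b
      · simp [inp]
      · simp [inp] at h1
  · rintro ⟨h1, h2⟩
    cases L with
    | nil => simp at h1
    | cons p L =>
      obtain ⟨o, t⟩ := p
      simp only [List.map_cons, List.head?_cons, Option.some.injEq] at h1
      subst h1
      intro y hy hyO
      rw [flat_cons, List.infix_cons_iff] at hy
      rcases hy with hy | hy
      · rcases List.prefix_cons_iff.1 hy with rfl | ⟨t, rfl, -⟩ <;> simp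
      · exact FactorStandard.append_flat (hL (.I1, t) (by simp)) (h2 (.I1, t) (by simp))
          (fun p hp => hL p (by simp [hp])) (fun p hp => h2 p (by simp [hp])) hc.2.2 y hy hyO

theorem factorStandard_append {u v : List Op} (hu : OS u) :
    FactorStandard (u ++ v) ↔ FactorStandard u ∧ FactorStandard v := by
  constructor
  · exact fun h => ⟨h.of_infix (List.prefix_append _ _).isInfix,
      h.of_infix (List.suffix_append _ _).isInfix⟩
  · rintro ⟨h1, h2⟩ y hy hyO
    rcases infix_append_cases hy with hy | hy | ⟨y₁, y₂, rfl, ⟨x, hx⟩, hy2⟩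
    · exact h1 y hy hyO
    · exact h2 y hy hyO
    · have h3 : OS y₁ := operationSequence_overlap (x := x) (hx ▸ hu) hyO
      cases y₁ with
      | nil => exact h2 _ hy2.isInfix hyO
      | cons o y₁ => simpa using h1 (o :: y₁) ⟨x, [], by simpa using hx⟩ h3

/-! Exchange of the two stacks. -/

/-- Exchange the two stacks. -/
def Op.flip : Op → Op
  | .I1 => .I2
  | .I2 => .I1
  | .O1 => .O2
  | .O2 => .O1

@[simp] theorem flip_flip (o : Op) : o.flip.flip = o := by cases o <;> rfl

@[simp] theorem flip_inp (b : Bool) : (inp b).flip = inp !b := by cases b <;> rfl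

@[simp] theorem flip_out (b : Bool) : (out b).flip = out !b := by cases b <;> rfl

@[simp] theorem flip_comp_flip : Op.flip ∘ Op.flip = id := funext flip_flip

theorem flip_injective : Function.Injective Op.flip :=
  Function.LeftInverse.injective flip_flip

theorem count_map_flip (w : List Op) (o : Op) : (w.map Op.flip).count o = w.count o.flip := by
  conv_lhs => rw [← flip_flip o]
  exact List.count_map_of_injective w _ flip_injective _

theorem IsDyck.map_flip {b : Bool} {w : List Op} (h : IsDyck b w) :
    IsDyck (!b) (w.map Op.flip) := by
  refine ⟨by simpa [count_map_flip] using h.1, fun p hp => ?_⟩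
  have : p.map Op.flip <+: w := by simpa using hp.map Op.flip
  simpa [count_map_flip] using h.2 _ this

theorem operationSequence_map_flip {w : List Op} : OS (w.map Op.flip) ↔ OS w := by
  have key : ∀ w : List Op, OS w → OS (w.map Op.flip) := by
    intro w h
    rw [isOperationSequence_iff] at *
    intro b
    simpa using (h !b).map_flip
  exact ⟨fun h => by simpa using key _ h, key w⟩

theorem IsIrreducible.map_flip {c : List Op} (h : IsIrreducible c) :
    IsIrreducible (c.map Op.flip) := by
  refine ⟨operationSequence_map_flip.2 h.1, by simpa using h.2.1, fun y hy hyO => ?_⟩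
  rw [← List.map_tail] at hy
  have := h.2.2 (y.map Op.flip) (by simpa using hy.map Op.flip) (operationSequence_map_flip.2 hyO)
  simpa using this

theorem numItems_map_flip (w : List Op) : numItems (w.map Op.flip) = numItems w := by
  simp [numItems, count_map_flip, Op.flip, add_comm]

@[simp] theorem numItems_append (u v : List Op) : numItems (u ++ v) = numItems u + numItems v := by
  simp [numItems]; omega

@[simp] theorem numItems_nil : numItems [] = 0 := rfl

theorem numItems_cons (o : Op) (v : List Op) : numItems (o :: v) = numItems [o] + numItems v := by
  rw [← numItems_append]; rfl

@[simp] theorem numItems_inp (b : Bool) (v : List Op) :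
    numItems (inp b :: v) = numItems v + 1 := by
  rw [numItems_cons, add_comm]; cases b <;> rfl

@[simp] theorem numItems_out (b : Bool) (v : List Op) :
    numItems (out b :: v) = numItems v := by
  rw [numItems_cons]; cases b <;> simp [numItems, out]

theorem length_eq_counts (w : List Op) :
    w.length = numItems w + w.count .O1 + w.count .O2 := by
  induction w with
  | nil => rfl
  | cons o w ih => cases o <;> simp [numItems] at ih ⊢ <;> omega

theorem length_of_operationSequence {w : List Op} (h : OS w) : w.length = 2 * numItems w := by
  rw [length_eq_counts, ← h.1.1, ← h.1.2, numItems]; omega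

/-! Runs of the machine. -/

/-- The contents of the first (`false`) or second (`true`) stack. -/
def Config.stack (c : Config) : Bool → List ℕ
  | false => c.stack1
  | true => c.stack2

theorem step_inp {c c' : Config} {b : Bool} : c.step (inp b) = some c' ↔
    ∃ k, c.input = k :: c'.input ∧ c'.stack b = k :: c.stack b ∧ c'.stack (!b) = c.stack (!b) ∧
      c'.output = c.output := by
  obtain ⟨i, s, t, o⟩ := c
  obtain ⟨i', s', t', o'⟩ := c'
  cases b <;> cases i <;> simp [Config.step, Config.stack, inp] <;> grind

theorem step_out {c c' : Config} {b : Bool} : c.step (out b) = some c' ↔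
    ∃ k, c.stack b = k :: c'.stack b ∧ c'.stack (!b) = c.stack (!b) ∧ c'.input = c.input ∧
      c'.output = c.output ++ [k] := by
  obtain ⟨i, s, t, o⟩ := c
  obtain ⟨i', s', t', o'⟩ := c'
  cases b
  · cases s <;> cases i <;> simp [Config.step, Config.stack, out] <;> grind
  · cases t <;> cases i <;> cases s <;> simp [Config.step, Config.stack, out] <;> grind

@[simp] theorem run_nil (c : Config) : c.run [] = some c := rfl

theorem run_cons (c : Config) (o : Op) (w : List Op) :
    c.run (o :: w) = (c.step o).bind fun c' => c'.run w := rfl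

theorem run_append (c : Config) (u v : List Op) :
    c.run (u ++ v) = (c.run u).bind fun c' => c'.run v := by
  induction u generalizing c with
  | nil => rfl
  | cons o u ih =>
    rw [List.cons_append, run_cons, run_cons, Option.bind_assoc]
    congr 1
    funext d
    exact ih d

theorem run_append_eq_some {c c' : Config} {u v : List Op} :
    c.run (u ++ v) = some c' ↔ ∃ d, c.run u = some d ∧ d.run v = some c' := by
  rw [run_append, Option.bind_eq_some_iff]

theorem run_cons_eq_some {c c' : Config} {o : Op} {v : List Op} :
    c.run (o :: v) = some c' ↔ ∃ d, c.step o = some d ∧ d.run v = some c' := by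
  rw [run_cons, Option.bind_eq_some_iff]

theorem run_singleton (c : Config) (o : Op) : c.run [o] = c.step o := by
  rw [run_cons]
  cases c.step o <;> rfl

theorem run_input {c c' : Config} {w : List Op} (h : c.run w = some c') :
    ∃ l, c.input = l ++ c'.input ∧ l.length = numItems w := by
  induction w generalizing c with
  | nil =>
    obtain rfl : c = c' := by simpa using h
    exact ⟨[], rfl, rfl⟩
  | cons o w ih =>
    obtain ⟨d, h1, h2⟩ := run_cons_eq_some.1 h
    obtain ⟨l, e, hl⟩ := ih h2
    obtain ⟨b, rfl | rfl⟩ := op_cases o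
    · obtain ⟨k, e1, -⟩ := step_inp.1 h1
      exact ⟨k :: l, by rw [e1, e]; rfl, by simp [hl]⟩
    · obtain ⟨k, -, -, e1, -⟩ := step_out.1 h1
      exact ⟨l, by rw [← e1, e], by simp [hl]⟩

theorem run_output {c c' : Config} {w : List Op} (h : c.run w = some c') :
    ∃ l, c'.output = c.output ++ l ∧ l.length + numItems w = w.length := by
  induction w generalizing c with
  | nil =>
    obtain rfl : c = c' := by simpa using h
    exact ⟨[], by simp, rfl⟩
  | cons o w ih =>
    obtain ⟨d, h1, h2⟩ := run_cons_eq_some.1 h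
    obtain ⟨l, e, hl⟩ := ih h2
    obtain ⟨b, rfl | rfl⟩ := op_cases o
    · obtain ⟨k, -, -, -, e1⟩ := step_inp.1 h1
      exact ⟨l, by rw [e, e1], by simp; omega⟩
    · obtain ⟨k, -, -, -, e1⟩ := step_out.1 h1
      exact ⟨k :: l, by rw [e, e1]; simp, by simp; omega⟩

/-- All items in a configuration. -/
def Config.items (c : Config) : List ℕ := c.input ++ (c.stack1 ++ (c.stack2 ++ c.output))

theorem Config.items_perm (c : Config) (b : Bool) :
    c.items.Perm (c.input ++ (c.stack b ++ (c.stack (!b) ++ c.output))) := by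
  cases b
  · exact .refl _
  · refine List.Perm.append_left _ ?_
    rw [← List.append_assoc, ← List.append_assoc]
    exact List.Perm.append_right _ List.perm_append_comm

theorem step_items {c c' : Config} {o : Op} (h : c.step o = some c') :
    c'.items.Perm c.items := by
  obtain ⟨b, rfl | rfl⟩ := op_cases o
  · obtain ⟨k, e1, e2, e3, e4⟩ := step_inp.1 h
    refine (c'.items_perm b).trans (.trans ?_ (c.items_perm b).symm)
    rw [e1, e2, e3, e4]
    simp
  · obtain ⟨k, e1, e2, e3, e4⟩ := step_out.1 h
    refine (c'.items_perm b).trans (.trans ?_ (c.items_perm b).symm)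
    rw [e1, e2, e3, e4]
    refine List.Perm.append_left _ ?_
    rw [← List.append_assoc, ← List.append_assoc]
    refine List.perm_append_comm.trans ?_
    simp

theorem run_items {c c' : Config} {w : List Op} (h : c.run w = some c') :
    c'.items.Perm c.items := by
  induction w generalizing c with
  | nil =>
    obtain rfl : c = c' := by simpa using h
    exact .refl _
  | cons o w ih =>
    obtain ⟨d, h1, h2⟩ := run_cons_eq_some.1 h
    exact (ih h2).trans (step_items h1)

theorem run_stack_length {c c' : Config} {w : List Op} (h : c.run w = some c') (b : Bool) :
    (c'.stack b).length + w.count (out b) = (c.stack b).length + w.count (inp b) := by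
  induction w generalizing c with
  | nil =>
    obtain rfl : c = c' := by simpa using h
    rfl
  | cons o w ih =>
    obtain ⟨d, h1, h2⟩ := run_cons_eq_some.1 h
    have := ih h2
    obtain ⟨b', rfl | rfl⟩ := op_cases o
    · obtain ⟨k, -, e2, e3, -⟩ := step_inp.1 h1
      by_cases hb : b' = b
      · subst hb
        simp [e2] at this ⊢
        omega
      · obtain rfl : b = !b' := by cases b <;> cases b' <;> simp_all
        simp [e3] at this ⊢
        omega
    · obtain ⟨k, e2, e3, -⟩ := step_out.1 h1
      by_cases hb : b' = b
      · subst hb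
        simp [e2] at this ⊢
        omega
      · obtain rfl : b = !b' := by cases b <;> cases b' <;> simp_all
        simp [e3] at this ⊢
        omega

theorem run_stack {c c' : Config} {w : List Op} {b : Bool}
    (hw : ∀ p, p <+: w → p.count (out b) ≤ p.count (inp b)) (h : c.run w = some c') :
    ∃ l, c'.stack b = l ++ c.stack b := by
  induction w using List.reverseRecOn generalizing c' with
  | nil =>
    obtain rfl : c = c' := by simpa using h
    exact ⟨[], rfl⟩
  | append_singleton w o ih =>
    obtain ⟨d, h1, h2⟩ := run_append_eq_some.1 h
    rw [run_singleton] at h2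
    obtain ⟨l, e⟩ := ih (fun p hp => hw p (hp.trans (List.prefix_append _ _))) h1
    obtain ⟨b', rfl | rfl⟩ := op_cases o
    · obtain ⟨k, -, e2, e3, -⟩ := step_inp.1 h2
      by_cases hb : b' = b
      · subst hb
        exact ⟨k :: l, by rw [e2, e]; rfl⟩
      · obtain rfl : b = !b' := by cases b <;> cases b' <;> simp_all
        exact ⟨l, by rw [e3, e]⟩
    · obtain ⟨k, e2, e3, -⟩ := step_out.1 h2
      by_cases hb : b' = b
      · subst hb
        have h3 := run_stack_length h1 b'
        have h4 := hw _ List.prefix_rfl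
        rw [e] at h3 e2
        cases l with
        | nil => simp at h3 h4; omega
        | cons m l =>
          simp only [List.cons_append, List.cons.injEq] at e2
          exact ⟨l, e2.2.symm⟩
      · obtain rfl : b = !b' := by cases b <;> cases b' <;> simp_all
        exact ⟨l, by rw [e3, e]⟩

theorem IsDyck.run_stack {c c' : Config} {w : List Op} {b : Bool} (hw : IsDyck b w)
    (h : c.run w = some c') : c'.stack b = c.stack b := by
  obtain ⟨l, e⟩ := TwoStacks.run_stack hw.2 h
  have := run_stack_length h b
  rw [e, hw.1] at this
  have : l = [] := by simpa using this
  rw [e, this, List.nil_append]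

/-- The prefix condition keeps outputs from meeting an empty stack, and the length condition keeps
inputs from running out. -/
theorem exists_run {c : Config} {w : List Op}
    (hw : ∀ b p, p <+: w → p.count (out b) ≤ p.count (inp b)) (hc : numItems w ≤ c.input.length) :
    ∃ c', c.run w = some c' := by
  induction w using List.reverseRecOn with
  | nil => exact ⟨c, rfl⟩
  | append_singleton w o ih =>
    rw [numItems_append] at hc
    obtain ⟨d, h1⟩ := ih (fun b p hp => hw b p (hp.trans (List.prefix_append _ _))) (by omega)
    simp only [run_append_eq_some, h1, run_singleton, Option.some.injEq, exists_eq_left']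
    obtain ⟨b, rfl | rfl⟩ := op_cases o
    · obtain ⟨l, e, hl⟩ := run_input h1
      have h2 := congrArg List.length e
      simp at h2 hc
      obtain ⟨i, s, t, u⟩ := d
      cases i with
      | nil => simp at h2; omega
      | cons k i => cases b <;> exact ⟨_, rfl⟩
    · have h3 := run_stack_length h1 b
      have h4 := hw b _ List.prefix_rfl
      have h5 : d.stack b ≠ [] := by
        intro h
        simp [h] at h3 h4
        omega
      obtain ⟨i, s, t, u⟩ := d
      cases b
      · cases s with
        | nil => exact absurd rfl h5
        | cons k r => cases i <;> exact ⟨_, rfl⟩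
      · cases t with
        | nil => exact absurd rfl h5
        | cons k r => cases i <;> cases s <;> exact ⟨_, rfl⟩

/-! Configurations along an operation sequence. -/

theorem init_input (n : ℕ) : (Config.init n).input = List.range' 1 n := rfl

theorem init_run_input {n : ℕ} {c : Config} {w : List Op} (h : (Config.init n).run w = some c) :
    c.input = List.range' (1 + numItems w) (n - numItems w) ∧ numItems w ≤ n := by
  obtain ⟨l, e, hl⟩ := run_input h
  rw [init_input] at e
  have e1 := congrArg List.length e
  simp at e1
  have e2 := congrArg (List.drop (numItems w)) e
  rw [List.drop_range', ← hl, List.drop_left] at e2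
  rw [← e2, hl]
  simp
  omega

theorem configAt_isSome {w : List Op} (hw : OS w) (i : ℕ) : ∃ c, configAt w i = some c := by
  refine exists_run (fun b p hp => ?_) ?_
  · exact (isOperationSequence_iff.1 hw b).2 p (hp.trans (List.take_prefix _ _))
  · have := numItems_append (w.take i) (w.drop i)
    rw [List.take_append_drop] at this
    rw [init_input, List.length_range']
    omega

theorem configAt_le {w : List Op} {i j : ℕ} (hij : i ≤ j) {c d : Config}
    (hc : configAt w i = some c) (hd : configAt w j = some d) :
    (∀ k, k ∈ d.input → k ∈ c.input) ∧ (∀ k, k ∈ c.output → k ∈ d.output) := by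
  unfold configAt at hc hd
  obtain ⟨t, ht⟩ : w.take i <+: w.take j := List.take_prefix_take_left hij
  rw [← ht, run_append_eq_some] at hd
  obtain ⟨c', h1, h2⟩ := hd
  obtain rfl : c = c' := by rw [hc] at h1; simpa using h1
  obtain ⟨l, e, -⟩ := run_input h2
  obtain ⟨l', e', -⟩ := run_output h2
  exact ⟨fun k hk => by simp [e, hk], fun k hk => by simp [e', hk]⟩

theorem InputAt.unique {w : List Op} {k i j : ℕ} (h : InputAt w k i) (h' : InputAt w k j) :
    i = j := by
  obtain ⟨c, d, h1, h2, h3, h4⟩ := h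
  obtain ⟨c', d', h1', h2', h3', h4'⟩ := h'
  by_contra hne
  rcases Nat.lt_or_gt_of_ne hne with hlt | hlt
  · exact h4 ((configAt_le hlt h2 h1').1 k h3')
  · exact h4' ((configAt_le hlt h2' h1).1 k h3)

theorem OutputAt.unique {w : List Op} {k i j : ℕ} (h : OutputAt w k i) (h' : OutputAt w k j) :
    i = j := by
  obtain ⟨c, d, h1, h2, h3, h4⟩ := h
  obtain ⟨c', d', h1', h2', h3', h4'⟩ := h'
  by_contra hne
  rcases Nat.lt_or_gt_of_ne hne with hlt | hlt
  · exact h3' ((configAt_le hlt h2 h1').2 k h4)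
  · exact h3 ((configAt_le hlt h2' h1).2 k h4')

theorem split_at {w : List Op} {i : ℕ} (h : i < w.length) :
    ∃ x o z, w = x ++ o :: z ∧ x.length = i ∧ w.take i = x ∧ w.take (i + 1) = x ++ [o] := by
  refine ⟨w.take i, w[i], w.drop (i + 1), by simp, by simp; omega, rfl, by simp⟩

theorem inputAt_of_split {w x z : List Op} {b : Bool} (hw : OS w) (h : w = x ++ inp b :: z) :
    InputAt w (numItems x + 1) x.length := by
  obtain ⟨c, hc⟩ := configAt_isSome hw x.length
  obtain ⟨d, hd⟩ := configAt_isSome hw (x.length + 1)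
  refine ⟨c, d, hc, hd, ?_⟩
  subst h
  unfold configAt at hc hd
  have e : (x ++ inp b :: z).take (x.length + 1) = x ++ [inp b] := by simp [List.take_append]
  rw [List.take_left] at hc
  rw [e] at hd
  rw [(init_run_input hc).1, (init_run_input hd).1]
  simp [List.mem_range'_1, numItems_append]
  omega

theorem InputAt.split {w : List Op} {k i : ℕ} (hw : OS w) (h : InputAt w k i) :
    ∃ b x z, w = x ++ inp b :: z ∧ x.length = i ∧ k = numItems x + 1 := by
  obtain ⟨c, d, hc, hd, h1, h2⟩ := h
  unfold configAt at hc hd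
  by_cases hi : i < w.length
  · obtain ⟨x, o, z, rfl, hx, e1, e2⟩ := split_at hi
    rw [e1] at hc
    rw [e2] at hd
    obtain ⟨c', h3, h4⟩ := run_append_eq_some.1 hd
    obtain rfl : c = c' := by rw [hc] at h3; simpa using h3
    rw [run_singleton] at h4
    obtain ⟨b, rfl | rfl⟩ := op_cases o
    · refine ⟨b, x, z, rfl, hx, ?_⟩
      rw [(init_run_input hc).1] at h1
      rw [(init_run_input hd).1] at h2
      simp [List.mem_range'_1] at h1 h2
      omega
    · obtain ⟨m, -, -, e, -⟩ := step_out.1 h4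
      rw [e] at h2
      exact absurd h1 h2
  · rw [List.take_of_length_le (by omega)] at hc hd
    obtain rfl : c = d := by rw [hc] at hd; simpa using hd
    exact absurd h1 h2

/-! Arches, as pairs of positions. -/

/-- The letters at positions `i < j` are an input to and an output from the stack `b`, and move
the same item. -/
def Arch (b : Bool) (w : List Op) (i j : ℕ) : Prop :=
  ∃ x y z, w = x ++ inp b :: (y ++ out b :: z) ∧ x.length = i ∧ j = i + 1 + y.length ∧ IsDyck b y

theorem exists_first_return {b : Bool} {z : List Op}
    (h : ∃ p, p <+: z ∧ p.count (inp b) < p.count (out b)) :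
    ∃ y z', z = y ++ out b :: z' ∧ IsDyck b y := by
  induction z using List.reverseRecOn with
  | nil => simp at h
  | append_singleton v o ih =>
    by_cases hv : ∃ p, p <+: v ∧ p.count (inp b) < p.count (out b)
    · obtain ⟨y, z', rfl, hy⟩ := ih hv
      exact ⟨y, z' ++ [o], by simp, hy⟩
    · push Not at hv
      obtain ⟨p, hp, h⟩ := h
      rcases List.prefix_concat_iff.1 hp with rfl | hp
      · have h1 := hv v List.prefix_rfl
        obtain ⟨b', rfl | rfl⟩ := op_cases o
        · simp [List.count_append, List.count_singleton] at h; omega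
        · by_cases hb : b' = b
          · subst hb
            simp at h
            exact ⟨v, [], rfl, by omega, hv⟩
          · simp [hb] at h; omega
      · have := hv p hp
        omega

theorem exists_last_ascent {b : Bool} {z : List Op}
    (h : ∃ p, p <:+ z ∧ p.count (out b) < p.count (inp b)) :
    ∃ x y, z = x ++ inp b :: y ∧ IsDyck b y := by
  induction z with
  | nil => simp at h
  | cons o v ih =>
    by_cases hv : ∃ p, p <:+ v ∧ p.count (out b) < p.count (inp b)
    · obtain ⟨x, y, rfl, hy⟩ := ih hv
      exact ⟨o :: x, y, rfl, hy⟩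
    · push Not at hv
      obtain ⟨p, hp, h⟩ := h
      rcases List.suffix_cons_iff.1 hp with rfl | hp
      · have h1 := hv v List.suffix_rfl
        obtain ⟨b', rfl | rfl⟩ := op_cases o
        · by_cases hb : b' = b
          · subst hb
            simp at h
            refine ⟨[], v, rfl, by omega, ?_⟩
            rintro p ⟨t, rfl⟩
            have := hv t (List.suffix_append _ _)
            simp at h h1
            omega
          · simp [hb] at h; omega
        · simp [List.count_cons] at h; omega
      · have := hv p hp
        omega

theorem IsDyck.exists_arch_of_inp {b : Bool} {x z : List Op} (h : IsDyck b (x ++ inp b :: z)) :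
    ∃ y z', z = y ++ out b :: z' ∧ IsDyck b y := by
  refine exists_first_return ⟨z, List.prefix_rfl, ?_⟩
  have h1 := h.1
  have h2 := h.2 x (List.prefix_append _ _)
  simp at h1
  omega

theorem IsDyck.exists_arch_of_out {b : Bool} {v z : List Op} (h : IsDyck b (v ++ out b :: z)) :
    ∃ x y, v = x ++ inp b :: y ∧ IsDyck b y := by
  refine exists_last_ascent ⟨v, List.suffix_rfl, ?_⟩
  have h2 := h.2 (v ++ [out b]) (by simp)
  simp at h2
  omega

theorem outputAt_of_split {w x y z : List Op} {b : Bool} (hw : OS w)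
    (h : w = x ++ inp b :: (y ++ out b :: z)) (hy : IsDyck b y) :
    OutputAt w (numItems x + 1) (x.length + 1 + y.length) := by
  set j := x.length + 1 + y.length with hj
  obtain ⟨c, hc⟩ := configAt_isSome hw j
  obtain ⟨d, hd⟩ := configAt_isSome hw (j + 1)
  refine ⟨c, d, hc, hd, ?_⟩
  subst h
  unfold configAt at hc hd
  have e1 : (x ++ inp b :: (y ++ out b :: z)).take j = x ++ inp b :: y := by
    rw [show x ++ inp b :: (y ++ out b :: z) = (x ++ inp b :: y) ++ out b :: z by simp,
      show j = (x ++ inp b :: y).length by simp [hj]; omega, List.take_left]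
  have e2 : (x ++ inp b :: (y ++ out b :: z)).take (j + 1) = (x ++ inp b :: y) ++ [out b] := by
    rw [show x ++ inp b :: (y ++ out b :: z) = ((x ++ inp b :: y) ++ [out b]) ++ z by simp,
      show j + 1 = ((x ++ inp b :: y) ++ [out b]).length by simp [hj]; omega, List.take_left]
  rw [e1] at hc
  rw [e2] at hd
  obtain ⟨c', h3, h4⟩ := run_append_eq_some.1 hd
  obtain rfl : c = c' := by rw [hc] at h3; simpa using h3
  rw [run_singleton] at h4
  obtain ⟨c₀, h5, h6⟩ := run_append_eq_some.1 hc
  obtain ⟨c₁, h7, h8⟩ := run_cons_eq_some.1 h6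
  obtain ⟨k, f1, f2, -⟩ := step_inp.1 h7
  have f3 := hy.run_stack h8
  obtain ⟨m, g1, -, -, g2⟩ := step_out.1 h4
  rw [f3, f2] at g1
  obtain ⟨rfl, -⟩ := List.cons.inj g1
  have h9 := (init_run_input h5).1
  rw [f1] at h9
  obtain rfl : k = numItems x + 1 := by
    have := (List.range'_eq_cons_iff.1 h9.symm).1
    omega
  -- The item is still on top of stack `b`, since `y` has restored that stack; were it also in the
  -- output, it would occur twice among the items.
  refine ⟨fun h => ?_, by simp [g2]⟩
  have hnd : c.items.Nodup := by
    refine (run_items hc).nodup_iff.2 ?_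
    simp [Config.items, Config.init, List.nodup_range']
  rw [(c.items_perm b).nodup_iff, f3, f2] at hnd
  simp [List.nodup_append, h] at hnd

/-- The bridge from arches seen by the machine to matched letters of the word; all crossing
arguments use the latter. -/
theorem isArch_iff {w : List Op} (hw : OS w) {k i j : ℕ} :
    IsArch w k i j ↔ ∃ b, Arch b w i j ∧ k = numItems (w.take i) + 1 := by
  constructor
  · rintro ⟨h1, h2⟩
    obtain ⟨b, x, z, rfl, rfl, rfl⟩ := h1.split hw
    obtain ⟨y, z', rfl, hy⟩ := (isOperationSequence_iff.1 hw b).exists_arch_of_inp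
    exact ⟨b, ⟨x, y, z', rfl, rfl, h2.unique (outputAt_of_split hw rfl hy), hy⟩, by simp⟩
  · rintro ⟨b, ⟨x, y, z, rfl, rfl, rfl, hy⟩, rfl⟩
    rw [List.take_left]
    exact ⟨inputAt_of_split hw rfl, outputAt_of_split hw rfl hy⟩

theorem Arch.getElem_inp {b : Bool} {w : List Op} {i j : ℕ} (h : Arch b w i j) :
    w[i]? = some (inp b) := by
  obtain ⟨x, y, z, rfl, rfl, rfl, hy⟩ := h
  simp

theorem Arch.getElem_out {b : Bool} {w : List Op} {i j : ℕ} (h : Arch b w i j) :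
    w[j]? = some (out b) := by
  obtain ⟨x, y, z, rfl, rfl, rfl, hy⟩ := h
  rw [List.getElem?_append_right (by omega)]
  rw [show x.length + 1 + y.length - x.length = y.length + 1 by omega]
  simp

theorem Arch.lt {b : Bool} {w : List Op} {i j : ℕ} (h : Arch b w i j) : i < j := by
  obtain ⟨x, y, z, rfl, rfl, rfl, hy⟩ := h
  omega

/-- The number of items in stack `b` after the first `t` operations. -/
def height (b : Bool) (w : List Op) (t : ℕ) : ℤ :=
  (w.take t).count (inp b) - (w.take t).count (out b)

theorem height_append (b : Bool) (x y z : List Op) {t : ℕ} (ht : t ≤ y.length) :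
    height b (x ++ (y ++ z)) (x.length + t) = height b (x ++ (y ++ z)) x.length +
      ((y.take t).count (inp b) - (y.take t).count (out b)) := by
  simp [height, List.take_append, ht, List.take_of_length_le (Nat.le_add_right x.length t)]
  ring

theorem IsDyck.height {b : Bool} {x y z : List Op} (h : IsDyck b y) :
    (∀ t, x.length ≤ t → t ≤ x.length + y.length →
      height b (x ++ (y ++ z)) x.length ≤ height b (x ++ (y ++ z)) t) ∧
    height b (x ++ (y ++ z)) (x.length + y.length) = height b (x ++ (y ++ z)) x.length := by
  constructor
  · intro t h1 h2
    obtain ⟨s, rfl⟩ := Nat.exists_eq_add_of_le h1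
    rw [height_append b x y z (by omega)]
    have := h.2 _ (List.take_prefix s y)
    omega
  · rw [height_append b x y z le_rfl, List.take_length]
    have := h.1
    omega

theorem Arch.height {b : Bool} {w : List Op} {i j : ℕ} (h : Arch b w i j) :
    height b w (i + 1) = height b w i + 1 ∧ height b w (j + 1) = height b w j - 1 ∧
    (∀ t, i + 1 ≤ t → t ≤ j → height b w (i + 1) ≤ height b w t) ∧
    height b w j = height b w (i + 1) := by
  obtain ⟨x, y, z, rfl, rfl, rfl, hy⟩ := h
  have h1 := height_append b x [inp b] (y ++ out b :: z) (t := 1) (by simp)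
  have h2 := height_append b (x ++ [inp b] ++ y) [out b] z (t := 1) (by simp)
  have h3 := hy.height (x := x ++ [inp b]) (z := out b :: z)
  simp at h1 h2 h3
  rw [← add_assoc] at h2
  simp only [show x.length + y.length + 1 = x.length + 1 + y.length by omega] at h2
  exact ⟨h1, by omega, h3⟩

/-- The arches of one colour do not cross. -/
theorem Arch.not_cross {b : Bool} {w : List Op} {i j i' j' : ℕ} (h : Arch b w i j)
    (h' : Arch b w i' j') (h1 : i < i') (h2 : i' < j) : j' < j := by
  obtain ⟨a1, a2, a3, a4⟩ := h.height
  obtain ⟨b1, b2, b3, b4⟩ := h'.height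
  by_contra hlt
  have := a3 i' (by omega) (by omega)
  have := b3 j (by omega) (by omega)
  omega

/-- The height stays at or above its initial value along `y` and returns to it at the end, whereas
strictly inside an arch it exceeds the height before the opening. An arch that left `y` on either
side would contradict this at the boundary crossed. -/
theorem Arch.mem_factor_iff {b : Bool} {w x y z : List Op} {i j : ℕ} (h : Arch b w i j)
    (hw : w = x ++ (y ++ z)) (hy : IsDyck b y) :
    (x.length ≤ i ∧ i < x.length + y.length) ↔ (x.length ≤ j ∧ j < x.length + y.length) := by
  obtain ⟨a1, a2, a3, a4⟩ := h.height
  have hlt := h.lt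
  have h3 := hy.height (x := x) (z := z)
  rw [← hw] at h3
  obtain ⟨h3, h4⟩ := h3
  constructor
  · rintro ⟨h1, h2⟩
    by_contra hj
    have := a3 (x.length + y.length) (by omega) (by omega)
    have := h3 i (by omega) (by omega)
    omega
  · rintro ⟨h1, h2⟩
    by_contra hj
    have := a3 x.length (by omega) (by omega)
    have := h3 (j + 1) (by omega) (by omega)
    omega

/-- A failure of the Dyck condition in `y` produces an output whose input lies before `y`, or an
input whose output lies after it. -/
theorem isDyck_of_mem_factor_iff {b : Bool} {w x y z : List Op} (hD : IsDyck b w)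
    (hw : w = x ++ (y ++ z))
    (h : ∀ i j, Arch b w i j →
      ((x.length ≤ i ∧ i < x.length + y.length) ↔ (x.length ≤ j ∧ j < x.length + y.length))) :
    IsDyck b y := by
  have h1 : ∀ p, p <+: y → p.count (out b) ≤ p.count (inp b) := by
    by_contra hp
    push Not at hp
    obtain ⟨y₁, y₂, rfl, hy⟩ := exists_first_return hp
    obtain ⟨v, u, e, hu⟩ := IsDyck.exists_arch_of_out (b := b) (v := x ++ y₁) (z := y₂ ++ z)
      (by simpa [hw] using hD)
    have ha : Arch b w v.length (v.length + 1 + u.length) := by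
      refine ⟨v, u, y₂ ++ z, ?_, rfl, rfl, hu⟩
      have : w = (x ++ y₁) ++ out b :: (y₂ ++ z) := by simp [hw]
      rw [this, e]
      simp
    have e1 := congrArg List.length e
    simp at e1
    have := (h _ _ ha).2 (by simp; omega)
    simp at this
    obtain ⟨a1, a2, a3, a4⟩ := ha.height
    have hh := (hy.height (x := x) (z := out b :: (y₂ ++ z))).1 v.length this.1 (by omega)
    have hh' := (hy.height (x := x) (z := out b :: (y₂ ++ z))).2
    have e2 : w = x ++ (y₁ ++ out b :: (y₂ ++ z)) := by simp [hw]
    -- The arch closed by the first excess output opens one level below the height at the start of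
    -- `y`, a level not reached along the Dyck word `y₁`.
    rw [← e2] at hh hh'
    rw [show v.length + 1 + u.length = x.length + y₁.length by omega] at a4
    omega
  have h2 := h1 y List.prefix_rfl
  refine ⟨?_, h1⟩
  by_contra hne
  obtain ⟨y₁, y₂, rfl, hy⟩ := exists_last_ascent (b := b) (z := y) ⟨y, List.suffix_rfl, by omega⟩
  obtain ⟨u, t, e, hu⟩ := IsDyck.exists_arch_of_inp (b := b) (x := x ++ y₁) (z := y₂ ++ z)
    (by simpa [hw] using hD)
  have ha : Arch b w (x ++ y₁).length ((x ++ y₁).length + 1 + u.length) := by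
    refine ⟨x ++ y₁, u, t, ?_, rfl, rfl, hu⟩
    rw [hw, ← e]
    simp
  have := (h _ _ ha).1 (by simp)
  simp at this
  obtain ⟨a1, a2, a3, a4⟩ := ha.height
  have hh := (hy.height (x := x ++ y₁ ++ [inp b]) (z := z))
  have e2 : w = x ++ y₁ ++ [inp b] ++ (y₂ ++ z) := by simp [hw]
  rw [← e2] at hh
  simp only [List.length_append, List.length_singleton] at *
  have := hh.1 (x.length + y₁.length + 1 + u.length + 1) (by omega) (by omega)
  omega

/-! The graph of an operation sequence. -/

theorem IsArch.unique {w : List Op} {k i j i' j' : ℕ} (h : IsArch w k i j)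
    (h' : IsArch w k i' j') : i = i' ∧ j = j' :=
  ⟨h.1.unique h'.1, h.2.unique h'.2⟩

theorem isRed_iff {w : List Op} {k i : ℕ} (h : InputAt w k i) :
    IsRed w k ↔ w[i]? = some .I1 :=
  ⟨fun ⟨_, h1, h2⟩ => h1.unique h ▸ h2, fun h1 => ⟨i, h, h1⟩⟩

theorem isBlue_iff {w : List Op} {k i : ℕ} (h : InputAt w k i) :
    IsBlue w k ↔ w[i]? = some .I2 :=
  ⟨fun ⟨_, h1, h2⟩ => h1.unique h ▸ h2, fun h1 => ⟨i, h, h1⟩⟩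

theorem crosses_iff {w : List Op} (hw : OS w) {k l i j i' j' : ℕ} (h : IsArch w k i j)
    (h' : IsArch w l i' j') : Crosses w k l ↔ i < i' ∧ i' < j ∧ j < j' := by
  constructor
  · rintro ⟨-, i₁, j₁, i₂, j₂, h1, h2, h3⟩
    obtain ⟨rfl, rfl⟩ := h1.unique h
    obtain ⟨rfl, rfl⟩ := h2.unique h'
    exact h3
  · intro hc
    refine ⟨?_, i, j, i', j', h, h', hc⟩
    obtain ⟨b, hb, -⟩ := (isArch_iff hw).1 h
    obtain ⟨b', hb', -⟩ := (isArch_iff hw).1 h'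
    rw [isRed_iff h.1, isRed_iff h'.1, isBlue_iff h.1, isBlue_iff h'.1, hb.getElem_inp,
      hb'.getElem_inp]
    have : b ≠ b' := by
      rintro rfl
      have := hb.not_cross hb' hc.1 hc.2.1
      omega
    cases b <;> cases b' <;> simp_all [inp]

theorem archGraph_adj {w : List Op} {k l : ℕ} :
    (archGraph w).Adj k l ↔ k ≠ l ∧ (Crosses w k l ∨ Crosses w l k) := by
  simp [archGraph]

theorem archGraph_adj_iff {w : List Op} (hw : OS w) {k l i j i' j' : ℕ} (h : IsArch w k i j)
    (h' : IsArch w l i' j') :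
    (archGraph w).Adj k l ↔ i < i' ∧ i' < j ∧ j < j' ∨ i' < i ∧ i < j' ∧ j' < j := by
  rw [archGraph_adj, crosses_iff hw h h', crosses_iff hw h' h, and_iff_right_iff_imp]
  rintro hc rfl
  obtain ⟨rfl, rfl⟩ := h.unique h'
  omega

theorem exists_isArch_of_adj {w : List Op} {k l : ℕ} (h : (archGraph w).Adj k l) :
    ∃ i j, IsArch w l i j := by
  rcases (archGraph_adj.1 h).2 with ⟨-, i, j, i', j', -, h, -⟩ | ⟨-, i, j, i', j', h, -⟩
  exacts [⟨_, _, h⟩, ⟨_, _, h⟩]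

theorem exists_isArch_of_reachable {w : List Op} {k l i j : ℕ} (hk : IsArch w k i j)
    (h : (archGraph w).Reachable k l) : ∃ i j, IsArch w l i j := by
  rw [SimpleGraph.reachable_iff_reflTransGen] at h
  cases h with
  | refl => exact ⟨i, j, hk⟩
  | tail _ h => exact exists_isArch_of_adj h

/-- A set of vertices that is closed under adjacency contains, with one vertex, every vertex
that is reachable from it. -/
theorem reachable_induction {w : List Op} {P : ℕ → Prop} {k l : ℕ}
    (h : (archGraph w).Reachable k l) (hk : P k)
    (hP : ∀ a b, (archGraph w).Reachable k a → (archGraph w).Adj a b → P a → P b) : P l := by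
  rw [SimpleGraph.reachable_iff_reflTransGen] at h
  induction h with
  | refl => exact hk
  | tail h1 h2 ih => exact hP _ _ ((SimpleGraph.reachable_iff_reflTransGen _ _).2 h1) h2 ih

theorem numItems_take_le (w : List Op) {i j : ℕ} (h : i ≤ j) :
    numItems (w.take i) ≤ numItems (w.take j) := by
  obtain ⟨t, ht⟩ : w.take i <+: w.take j := List.take_prefix_take_left h
  rw [← ht, numItems_append]
  omega

theorem IsArch.lt_iff {w : List Op} (hw : OS w) {k l i j i' j' : ℕ} (h : IsArch w k i j)
    (h' : IsArch w l i' j') : k < l ↔ i < i' := by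
  have key : ∀ {k l i j i' j' : ℕ}, IsArch w k i j → IsArch w l i' j' → i ≤ i' → k ≤ l := by
    intro k l i j i' j' h h' hii
    obtain ⟨b, -, rfl⟩ := (isArch_iff hw).1 h
    obtain ⟨b', -, rfl⟩ := (isArch_iff hw).1 h'
    have := numItems_take_le w hii
    omega
  constructor
  · intro hkl
    by_contra hle
    have := key h' h (by omega)
    omega
  · intro hii
    rcases (key h h' hii.le).lt_or_eq with hlt | rfl
    · exact hlt
    · have := (h.unique h').1
      omega

theorem IsArch.bounds {w : List Op} (hw : OS w) {k i j : ℕ} (h : IsArch w k i j) :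
    i < j ∧ j < w.length ∧ k ∈ Finset.Icc 1 (numItems w) := by
  obtain ⟨b, hb, rfl⟩ := (isArch_iff hw).1 h
  refine ⟨hb.lt, (List.getElem?_eq_some_iff.1 hb.getElem_out).1, ?_⟩
  obtain ⟨x, y, z, rfl, rfl, rfl, hy⟩ := hb
  rw [List.take_left]
  simp

theorem exists_isArch {w : List Op} (hw : OS w) {k : ℕ} (hk : k ∈ Finset.Icc 1 (numItems w)) :
    ∃ i j, IsArch w k i j := by
  have key : ∀ v : List Op, k ∈ Finset.Icc 1 (numItems v) →
      ∃ x b z, v = x ++ inp b :: z ∧ k = numItems x + 1 := by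
    intro v
    induction v using List.reverseRecOn with
    | nil => simp
    | append_singleton v o ih =>
      intro hk
      by_cases h : k ≤ numItems v
      · obtain ⟨x, b, z, rfl, e⟩ := ih (by simp at hk ⊢; omega)
        exact ⟨x, b, z ++ [o], by simp, e⟩
      · obtain ⟨b, rfl | rfl⟩ := op_cases o
        · exact ⟨v, b, [], rfl, by simp at hk; omega⟩
        · simp at hk; omega
  obtain ⟨x, b, z, rfl, rfl⟩ := key w hk
  obtain ⟨y, z', rfl, hy⟩ := (isOperationSequence_iff.1 hw b).exists_arch_of_inp
  exact ⟨_, _, inputAt_of_split hw rfl, outputAt_of_split hw rfl hy⟩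

/-- Distinct arches have distinct ends, and if their items are not adjacent then they are disjoint
or nested. -/
theorem IsArch.not_adj {w : List Op} (hw : OS w) {k l i j i' j' : ℕ} (h : IsArch w k i j)
    (h' : IsArch w l i' j') (hne : k ≠ l) (hadj : ¬ (archGraph w).Adj k l) :
    i < j ∧ i' < j' ∧ i ≠ i' ∧ i ≠ j' ∧ j ≠ i' ∧ j ≠ j' ∧ ¬ (i < i' ∧ i' < j ∧ j < j') ∧
      ¬ (i' < i ∧ i < j' ∧ j' < j) := by
  rw [archGraph_adj_iff hw h h', not_or] at hadj
  have h1 := h.lt_iff hw h'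
  have h2 := h'.lt_iff hw h
  obtain ⟨b, hb, -⟩ := (isArch_iff hw).1 h
  obtain ⟨b', hb', -⟩ := (isArch_iff hw).1 h'
  refine ⟨hb.lt, hb'.lt, by omega, ?_, ?_, ?_, hadj⟩
  · rintro rfl
    have := hb.getElem_inp.symm.trans hb'.getElem_out
    simp at this
  · rintro rfl
    have := hb.getElem_out.symm.trans hb'.getElem_inp
    simp at this
  · rintro rfl
    have := hb.getElem_out.symm.trans hb'.getElem_out
    simp at this
    subst this
    obtain ⟨a1, a2, a3, a4⟩ := hb.height
    obtain ⟨c1, c2, c3, c4⟩ := hb'.height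
    have := hb.lt
    have := hb'.lt
    rcases Nat.lt_or_gt_of_ne (show i ≠ i' by omega) with hlt | hlt
    · have := a3 i' (by omega) (by omega)
      omega
    · have := c3 i (by omega) (by omega)
      omega

/-! ### Connected components of arches and operation sequence factors. -/

/-- No arch leaves the factor `y`, so starting inside `y` is a property closed under crossing. The
component of the first arch of `y` thus stays in `y`, and that arch comes first in it, so it is red.
-/
theorem IsStandard.factorStandard {w : List Op} (hw : OS w) (h : IsStandard w) :
    FactorStandard w := by
  rintro y ⟨x, z, hxyz⟩ hy hI
  rw [List.append_assoc] at hxyz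
  obtain ⟨y', rfl⟩ : ∃ y', y = .I2 :: y' := by
    cases y with
    | nil => simp at hI
    | cons o y' => exact ⟨y', by simpa using hI⟩
  have hin : InputAt w (numItems x + 1) x.length :=
    inputAt_of_split (b := true) (z := y' ++ z) hw hxyz.symm
  have hk : numItems x + 1 ∈ Finset.Icc 1 (numItems w) := by
    rw [← hxyz]
    rw [numItems_append, numItems_append, show numItems (.I2 :: y') = _ from numItems_inp true y',
      Finset.mem_Icc]
    omega
  obtain ⟨i, j, hij⟩ := exists_isArch hw hk
  obtain rfl := hij.1.unique hin
  have hred := h _ hk fun l hl => by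
    obtain ⟨i', j', hl', hi', -⟩ : ∃ i' j', IsArch w l i' j' ∧ x.length ≤ i' ∧
        i' < x.length + (Op.I2 :: y').length := by
      refine reachable_induction (P := fun l => ∃ i' j', IsArch w l i' j' ∧ x.length ≤ i' ∧
        i' < x.length + (Op.I2 :: y').length) hl ⟨_, _, hij, le_rfl, by simp⟩ ?_
      rintro a c - hac ⟨i, j, ha, hi⟩
      obtain ⟨i', j', hc⟩ := exists_isArch_of_adj hac
      refine ⟨i', j', hc, ?_⟩
      obtain ⟨b, hb, -⟩ := (isArch_iff hw).1 ha
      obtain ⟨b', hb', -⟩ := (isArch_iff hw).1 hc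
      have e := hb.mem_factor_iff hxyz.symm (isOperationSequence_iff.1 hy b)
      have e' := hb'.mem_factor_iff hxyz.symm (isOperationSequence_iff.1 hy b')
      rw [archGraph_adj_iff hw ha hc] at hac
      omega
    have := hl'.lt_iff hw hij
    omega
  rw [isRed_iff hin, ← hxyz] at hred
  simp at hred

/-- If the arch of `k` starts first in its connected component, then it starts an operation
sequence factor. -/
theorem exists_factor_of_first {w : List Op} (hw : OS w) {k i₀ j₀ : ℕ} (hk : IsArch w k i₀ j₀)
    (hfirst : ∀ l, (archGraph w).Reachable k l → k ≤ l) :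
    ∃ x y z, w = x ++ (y ++ z) ∧ x.length = i₀ ∧ y ≠ [] ∧ OS y := by
  classical
  have hb0 := hk.bounds hw
  set J : Finset ℕ := (Finset.range w.length).filter fun j =>
    ∃ l i, (archGraph w).Reachable k l ∧ IsArch w l i j with hJ
  have hmem : ∀ {l i j}, (archGraph w).Reachable k l → IsArch w l i j → j ∈ J := by
    intro l i j h1 h2
    simp only [hJ, Finset.mem_filter, Finset.mem_range]
    exact ⟨(h2.bounds hw).2.1, l, i, h1, h2⟩
  have hne : J.Nonempty := ⟨j₀, hmem (SimpleGraph.Reachable.refl _) hk⟩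
  set jm := J.max' hne with hjm
  have hmax : ∀ {l i j}, (archGraph w).Reachable k l → IsArch w l i j → j ≤ jm :=
    fun h1 h2 => J.le_max' _ (hmem h1 h2)
  have hjmem := J.max'_mem hne
  rw [← hjm] at hjmem
  simp only [hJ, Finset.mem_filter, Finset.mem_range] at hjmem
  obtain ⟨hjw, lm, im, hrm, ham⟩ := hjmem
  have h0m := hmax (SimpleGraph.Reachable.refl k) hk
  -- The factor spans the whole component, from its first input to its last output `jm`, included.
  set y := (w.drop i₀).take (jm + 1 - i₀) with hy
  have hlen : y.length = jm + 1 - i₀ := by simp [hy]; omega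
  have hsplit : w = w.take i₀ ++ (y ++ (w.drop i₀).drop (jm + 1 - i₀)) := by
    rw [hy, List.take_append_drop, List.take_append_drop]
  have hx : (w.take i₀).length = i₀ := by simp; omega
  refine ⟨_, y, _, hsplit, hx, ?_, isOperationSequence_iff.2 fun b =>
    isDyck_of_mem_factor_iff (isOperationSequence_iff.1 hw b) hsplit ?_⟩
  · rw [← List.length_pos_iff_ne_nil]
    omega
  intro p q hpq
  rw [hx, hlen]
  have hpq' := hpq.lt
  have hm := (isArch_iff hw).2 ⟨b, hpq, rfl⟩
  set m := numItems (w.take p) + 1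
  by_cases hmr : (archGraph w).Reachable k m
  · have h1 := hmax hmr hm
    have h2 := hm.lt_iff hw hk
    have h3 := hfirst m hmr
    omega
  have hnadj : ∀ {l}, (archGraph w).Reachable k l → m ≠ l ∧ ¬ (archGraph w).Adj m l := by
    refine fun {l} hl => ⟨?_, fun hadj => hmr (hl.trans hadj.symm.reachable)⟩
    rintro rfl
    exact hmr hl
  -- An arch outside the component crosses none of its arches; if it encloses one of them, it
  -- therefore encloses all.
  have hclosed : ∀ {l l'}, (archGraph w).Reachable k l → (archGraph w).Reachable l l' →
      (∃ i j, IsArch w l i j ∧ p < i ∧ j < q) → ∃ i j, IsArch w l' i j ∧ p < i ∧ j < q := by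
    intro l l' hl hll' hin
    refine reachable_induction (P := fun l => ∃ i j, IsArch w l i j ∧ p < i ∧ j < q) hll' hin ?_
    rintro a c hla hac ⟨i, j, ha, hi⟩
    obtain ⟨i', j', hc⟩ := exists_isArch_of_adj hac
    refine ⟨i', j', hc, ?_⟩
    have hkc := (hl.trans hla).trans hac.reachable
    have h1 := hm.not_adj hw hc (hnadj hkc).1 (hnadj hkc).2
    rw [archGraph_adj_iff hw ha hc] at hac
    omega
  have hn0 := hm.not_adj hw hk (hnadj (.refl k)).1 (hnadj (.refl k)).2
  have hnm := hm.not_adj hw ham (hnadj hrm).1 (hnadj hrm).2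
  have hmk := hm.lt_iff hw hk
  have him : i₀ ≤ im := by
    have := ham.lt_iff hw hk
    have := hfirst lm hrm
    omega
  by_contra hcon
  -- An outside arch with exactly one end in the span encloses the arch of `k` if it enters from the
  -- left, and that of `lm` if it exits to the right. It then encloses both, so neither of its ends
  -- lies in the span.
  by_cases hcase : p < i₀
  · obtain ⟨i, j, h1, h2⟩ := hclosed (.refl k) hrm ⟨i₀, j₀, hk, by omega⟩
    obtain ⟨rfl, rfl⟩ := h1.unique ham
    omega
  · obtain ⟨i, j, h1, h2⟩ := hclosed hrm hrm.symm ⟨im, jm, ham, by omega⟩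
    obtain ⟨rfl, rfl⟩ := h1.unique hk
    omega

theorem FactorStandard.isStandard {w : List Op} (hw : OS w) (h : FactorStandard w) :
    IsStandard w := by
  intro k hk hfirst
  obtain ⟨i, j, ha⟩ := exists_isArch hw hk
  obtain ⟨x, y, z, rfl, rfl, hne, hy⟩ := exists_factor_of_first hw ha hfirst
  obtain ⟨o, y, rfl⟩ := List.exists_cons_of_ne_nil hne
  rw [isRed_iff ha.1]
  obtain ⟨b, rfl⟩ := operationSequence_cons hy
  have := h _ ⟨x, z, by simp⟩ hy
  cases b <;> simp_all [inp]

theorem isStandard_iff {w : List Op} (hw : OS w) : IsStandard w ↔ FactorStandard w :=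
  ⟨IsStandard.factorStandard hw, FactorStandard.isStandard hw⟩

theorem outputsEagerly_iff {w : List Op} :
    OutputsEagerly w ↔ ∀ b, ¬ [inp b, out !b] <:+: w := by
  constructor
  · rintro ⟨h1, h2⟩ (_ | _)
    exacts [h1, h2]
  · exact fun h => ⟨h false, h true⟩

theorem OutputsEagerly.of_infix {v w : List Op} (h : OutputsEagerly w) (hv : v <:+: w) :
    OutputsEagerly v :=
  ⟨fun h1 => h.1 (h1.trans hv), fun h1 => h.2 (h1.trans hv)⟩

/-! Operation sequences produce permutations. -/

theorem Produces.operationSequence {n : ℕ} {w : List Op} {π : Equiv.Perm (Fin n)}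
    (h : Produces w π) : OS w ∧ numItems w = n := by
  unfold Produces at h
  refine ⟨isOperationSequence_iff.2 fun b => ⟨?_, ?_⟩, ?_⟩
  · have := run_stack_length h b
    cases b <;> simpa [Config.stack, Config.init, eq_comm] using this
  · rintro p ⟨t, rfl⟩
    obtain ⟨d, h1, -⟩ := run_append_eq_some.1 h
    have := run_stack_length h1 b
    cases b <;> simp [Config.stack, Config.init] at this ⊢ <;> omega
  · obtain ⟨h1, h2⟩ := init_run_input h
    have := congrArg List.length h1
    simp at this
    omega

theorem exists_perm_of_perm_range {n : ℕ} {l : List ℕ} (h : l.Perm (List.range' 1 n)) :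
    ∃ π : Equiv.Perm (Fin n), l = List.ofFn fun i => (π i : ℕ) + 1 := by
  have hl : l.length = n := by simpa using h.length_eq
  subst hl
  have hmem : ∀ i : Fin l.length, 1 ≤ l[i] ∧ l[i] < 1 + l.length := fun i =>
    List.mem_range'_1.1 (h.mem_iff.1 (List.getElem_mem i.2))
  have hnd : l.Nodup := h.nodup_iff.2 List.nodup_range'
  let f : Fin l.length → Fin l.length := fun i => ⟨l[i] - 1, by have := hmem i; omega⟩
  have hf : Function.Injective f := by
    intro i j hij
    have h1 := hmem i
    have h2 := hmem j
    have h3 : l[i] - 1 = l[j] - 1 := congrArg Fin.val hij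
    have h4 : l[i] = l[j] := by omega
    exact Fin.ext ((hnd.getElem_inj_iff (hi := i.2) (hj := j.2)).1 h4)
  refine ⟨Equiv.ofBijective f (Finite.injective_iff_bijective.1 hf), ?_⟩
  refine List.ext_getElem (by simp) fun i h1 h2 => ?_
  have := hmem ⟨i, h1⟩
  simp [f] at this ⊢
  omega

theorem exists_produces {w : List Op} (hw : OS w) {n : ℕ} (hn : numItems w = n) :
    ∃ π : Equiv.Perm (Fin n), Produces w π := by
  subst hn
  obtain ⟨c, hc⟩ := exists_run (c := Config.init (numItems w))
    (fun b => (isOperationSequence_iff.1 hw b).2) (by simp [init_input])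
  have h1 := (init_run_input hc).1
  have h2 := fun b => (isOperationSequence_iff.1 hw b).run_stack hc
  have h3 := run_items hc
  have hf := h2 false
  have ht := h2 true
  obtain ⟨i, s, t, u⟩ := c
  simp [Config.stack, Config.init] at h1 hf ht
  subst h1 hf ht
  obtain ⟨π, rfl⟩ := exists_perm_of_perm_range (l := u)
    (by simpa [Config.items, Config.init] using h3)
  exact ⟨π, hc⟩

/-! Every achievable permutation is produced by a canonical sequence: the smallest sequence that
produces it in the lexicographic order in which outputs come before inputs, and inputs to the first
stack before inputs to the second one. -/

/-- The rank of a letter in the order `O₁ < O₂ < I₁ < I₂`. -/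
def Op.rank : Op → ℕ
  | .O1 => 0
  | .O2 => 1
  | .I1 => 2
  | .I2 => 3

/-- The word, read as a number in base `4`. -/
def lexValue : List Op → ℕ
  | [] => 0
  | o :: w => o.rank * 4 ^ w.length + lexValue w

theorem lexValue_lt (w : List Op) : lexValue w < 4 ^ w.length := by
  induction w with
  | nil => simp [lexValue]
  | cons o w ih =>
    have : o.rank ≤ 3 := by cases o <;> simp [Op.rank]
    have := Nat.mul_le_mul_right (4 ^ w.length) this
    simp only [lexValue, List.length_cons, pow_succ]
    omega

theorem lexValue_cons_lt {o o' : Op} {u v : List Op} (h : o.rank < o'.rank)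
    (hl : u.length = v.length) : lexValue (o :: u) < lexValue (o' :: v) := by
  have h1 := lexValue_lt u
  have := Nat.mul_le_mul_right (4 ^ v.length) (Nat.succ_le_of_lt h)
  rw [Nat.succ_mul] at this
  simp only [lexValue, hl] at *
  omega

theorem lexValue_append_lt (x : List Op) {u v : List Op} (h : lexValue u < lexValue v)
    (hl : u.length = v.length) : lexValue (x ++ u) < lexValue (x ++ v) := by
  induction x with
  | nil => exact h
  | cons o x ih => simpa [lexValue, hl] using ih

theorem run_swap {c d : Config} {b : Bool} (h : c.run [inp b, out !b] = some d) :
    c.run [out !b, inp b] = some d := by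
  obtain ⟨i, s, t, u⟩ := c
  cases b <;> cases i <;> cases s <;> cases t <;>
    simp_all [Config.run, Config.step, inp, out]

/-- Such a word only touches items that it has itself input, so it adds `l₁` and `l₂` on top of the
old stacks, and exchanging the stacks exchanges these two additions. -/
theorem run_map_flip_aux {c d : Config} {w : List Op}
    (hw : ∀ b p, p <+: w → p.count (out b) ≤ p.count (inp b)) (h : c.run w = some d) :
    ∃ i u l₁ l₂, d = ⟨i, l₁ ++ c.stack1, l₂ ++ c.stack2, u⟩ ∧
      c.run (w.map Op.flip) = some ⟨i, l₂ ++ c.stack1, l₁ ++ c.stack2, u⟩ := by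
  induction w using List.reverseRecOn generalizing d with
  | nil =>
    obtain rfl : c = d := by simpa using h
    exact ⟨c.input, c.output, [], [], rfl, rfl⟩
  | append_singleton w o ih =>
    obtain ⟨e, h1, h2⟩ := run_append_eq_some.1 h
    rw [run_singleton] at h2
    obtain ⟨i, u, l₁, l₂, rfl, h3⟩ := ih (fun b p hp => hw b p (hp.trans (List.prefix_append _ _))) h1
    rw [List.map_append, run_append, h3, Option.bind_some, List.map_singleton, run_singleton]
    have hl := fun b => run_stack_length h1 b
    have hw' := fun b => hw b _ List.prefix_rfl
    have hl1 := hl false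
    have hl2 := hl true
    have hw1 := hw' false
    have hw2 := hw' true
    simp [Config.stack, inp, out] at hl1 hl2 hw1 hw2
    cases o
    · cases i with
      | nil => cases h : l₁ ++ c.stack1 <;> cases h' : l₂ ++ c.stack2 <;>
          simp [Config.step, h, h'] at h2
      | cons k i => exact ⟨i, u, k :: l₁, l₂, by simpa [Config.step, eq_comm] using h2, rfl⟩
    · cases i with
      | nil => cases h : l₁ ++ c.stack1 <;> cases h' : l₂ ++ c.stack2 <;>
          simp [Config.step, h, h'] at h2
      | cons k i => exact ⟨i, u, l₁, k :: l₂, by simpa [Config.step, eq_comm] using h2, rfl⟩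
    · cases l₁ with
      | nil => simp at hl1 hw1; omega
      | cons k l₁ =>
        refine ⟨i, u ++ [k], l₁, l₂, ?_, ?_⟩
        · cases i <;> simpa [Config.step, eq_comm] using h2
        · cases i <;> cases h : l₂ ++ c.stack1 <;> simp [Config.step, Op.flip]
    · cases l₂ with
      | nil => simp at hl2 hw2; omega
      | cons k l₂ =>
        refine ⟨i, u ++ [k], l₁, l₂, ?_, ?_⟩
        · cases i <;> cases h : l₁ ++ c.stack1 <;> simpa [Config.step, eq_comm, h] using h2
        · cases i <;> simp [Config.step, Op.flip]

theorem run_map_flip {c d : Config} {w : List Op} (hw : OS w) (h : c.run w = some d) :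
    c.run (w.map Op.flip) = some d := by
  have hw' := isOperationSequence_iff.1 hw
  obtain ⟨i, u, l₁, l₂, rfl, h1⟩ := run_map_flip_aux (fun b => (hw' b).2) h
  have h2 := (hw' false).run_stack h
  have h3 := (hw' true).run_stack h
  simp [Config.stack] at h2 h3
  subst h2 h3
  exact h1

theorem IsAchievable.exists_canonical {n : ℕ} {π : Equiv.Perm (Fin n)} (h : IsAchievable π) :
    ∃ w, IsCanonical w ∧ Produces w π := by
  obtain ⟨w, hw, hmin⟩ := (measure lexValue).wf.has_min {w | Produces w π} h
  have hO := hw.operationSequence.1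
  refine ⟨w, ⟨hO, FactorStandard.isStandard hO ?_, outputsEagerly_iff.2 ?_⟩, hw⟩
  · rintro y ⟨x, z, rfl⟩ hy hI
    obtain ⟨y', rfl⟩ : ∃ y', y = .I2 :: y' := by
      cases y with
      | nil => simp at hI
      | cons o y' => exact ⟨y', by simpa using hI⟩
    -- Flipping the factor does not change the effect of the word, but replaces its first letter
    -- `I₂` by the smaller `I₁`.
    refine hmin (x ++ (Op.I2 :: y').map Op.flip ++ z) ?_ ?_
    · obtain ⟨d, h1, h2⟩ := run_append_eq_some.1 hw
      obtain ⟨c, h3, h4⟩ := run_append_eq_some.1 h1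
      exact run_append_eq_some.2 ⟨d, run_append_eq_some.2 ⟨c, h3, run_map_flip hy h4⟩, h2⟩
    · change lexValue _ < lexValue _
      rw [List.append_assoc, List.append_assoc]
      exact lexValue_append_lt x (lexValue_cons_lt (by simp [Op.flip, Op.rank]) (by simp))
        (by simp)
  · rintro b ⟨x, z, rfl⟩
    refine hmin (x ++ [out !b, inp b] ++ z) ?_ ?_
    · obtain ⟨d, h1, h2⟩ := run_append_eq_some.1 hw
      obtain ⟨c, h3, h4⟩ := run_append_eq_some.1 h1
      exact run_append_eq_some.2 ⟨d, run_append_eq_some.2 ⟨c, h3, run_swap h4⟩, h2⟩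
    · change lexValue _ < lexValue _
      rw [List.append_assoc, List.append_assoc]
      exact lexValue_append_lt x
        (lexValue_cons_lt (by cases b <;> simp [inp, out, Op.rank]) (by simp)) (by simp)

/-! The canonical sequence that produces a permutation is unique. -/

/-- In an eager word, the first output after a run of inputs uses the stack of the last input, hence
pops an item input during the run. So the next item to be output was still waiting in the input. -/
theorem mem_input_of_eager {c f : Config} {b : Bool} {v : List Op} {k : ℕ} {r : List ℕ}
    (he : OutputsEagerly (inp b :: v)) (h : c.run (inp b :: v) = some f)
    (ho : f.output = c.output ++ k :: r) : k ∈ c.input := by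
  induction v generalizing b c with
  | nil =>
    rw [run_singleton] at h
    obtain ⟨m, -, -, -, e⟩ := step_inp.1 h
    simp [e] at ho
  | cons o v ih =>
    obtain ⟨d, h1, h2⟩ := run_cons_eq_some.1 h
    obtain ⟨m, e1, e2, e3, e4⟩ := step_inp.1 h1
    obtain ⟨b', rfl | rfl⟩ := op_cases o
    · rw [e1]
      exact List.mem_cons_of_mem _
        (ih (he.of_infix (List.suffix_cons _ _).isInfix) h2 (by rw [e4, ho]))
    · obtain rfl : b = b' := by
        by_contra hne
        obtain rfl : b' = !b := by cases b <;> cases b' <;> simp_all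
        exact outputsEagerly_iff.1 he b ⟨[], v, by simp⟩
      obtain ⟨d', h3, h4⟩ := run_cons_eq_some.1 h2
      obtain ⟨k', g1, g2, g3, g4⟩ := step_out.1 h3
      obtain ⟨l, e5, -⟩ := run_output h4
      rw [e2] at g1
      obtain ⟨rfl, -⟩ := List.cons.inj g1
      rw [g4, e4, ho, List.append_assoc] at e5
      have := List.append_cancel_left e5
      simp at this
      rw [e1, this.1]
      simp

/-- If an eager word inputs an item, then no eager word that starts with the same input and output
and ends with the same output starts by an output. -/
theorem eager_inp_out {c c' : Config} {b b' : Bool} {v v' : List Op} {f f' : Config}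
    (hi : c.input = c'.input) (ho : c.output = c'.output) (hf : f.output = f'.output)
    (he : OutputsEagerly (inp b :: v)) (h : c.run (inp b :: v) = some f)
    (h' : c'.run (out b' :: v') = some f') (hn : c'.items.Nodup) : False := by
  obtain ⟨d, h1, h2⟩ := run_cons_eq_some.1 h'
  obtain ⟨k, g1, -, -, g4⟩ := step_out.1 h1
  obtain ⟨l, e, -⟩ := run_output h2
  have := mem_input_of_eager he h (k := k) (r := l) (by rw [hf, e, g4, ho]; simp)
  rw [(c'.items_perm b').nodup_iff, g1, ← hi] at hn
  simp [List.nodup_append] at hn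
  grind

/-- The final output decides when an eager word must output: exactly when the next item wanted has
already been input. Only the choice of stacks remains free. -/
theorem eager_trace {c c' f : Config} {w w' : List Op} (hi : c.input = c'.input)
    (ho : c.output = c'.output) (he : OutputsEagerly w) (he' : OutputsEagerly w')
    (h : c.run w = some f) (h' : c'.run w' = some f) (hn : c.items.Nodup) (hn' : c'.items.Nodup) :
    w.length = w'.length ∧ ∀ i, ∃ d d', c.run (w.take i) = some d ∧ c'.run (w'.take i) = some d' ∧
      d.input = d'.input ∧ d.output = d'.output := by
  have hnil : ∀ {c c' f : Config} {o : Op} {v : List Op}, c.input = c'.input →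
      c.output = c'.output → c.run [] = some f → c'.run (o :: v) = some f → False := by
    intro c c' f o v hi ho h h'
    obtain rfl : c = f := by simpa using h
    obtain ⟨l, e, hl⟩ := run_input h'
    obtain ⟨l', e', hl'⟩ := run_output h'
    rw [hi] at e
    rw [ho] at e'
    simp at e e'
    subst e e'
    simp at hl hl'
    omega
  induction w generalizing w' c c' with
  | nil =>
    cases w' with
    | nil => exact ⟨rfl, fun i => ⟨c, c', by simp, by simp, hi, ho⟩⟩
    | cons o' v' => exact (hnil hi ho h h').elim
  | cons o v ih =>
    cases w' with
    | nil => exact (hnil hi.symm ho.symm h' h).elim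
    | cons o' v' =>
      obtain ⟨d, h1, h2⟩ := run_cons_eq_some.1 h
      obtain ⟨d', h1', h2'⟩ := run_cons_eq_some.1 h'
      have key : d.input = d'.input ∧ d.output = d'.output := by
        obtain ⟨b, rfl | rfl⟩ := op_cases o <;> obtain ⟨b', rfl | rfl⟩ := op_cases o'
        · obtain ⟨k, g1, -, -, g4⟩ := step_inp.1 h1
          obtain ⟨k', g1', -, -, g4'⟩ := step_inp.1 h1'
          rw [g1, g1'] at hi
          exact ⟨(List.cons.inj hi).2, by rw [g4, g4', ho]⟩
        · exact (eager_inp_out hi ho rfl he h h' hn').elim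
        · exact (eager_inp_out hi.symm ho.symm rfl he' h' h hn).elim
        · obtain ⟨k, -, -, g3, g4⟩ := step_out.1 h1
          obtain ⟨k', -, -, g3', g4'⟩ := step_out.1 h1'
          obtain ⟨l, e, -⟩ := run_output h2
          obtain ⟨l', e', -⟩ := run_output h2'
          rw [e, g4, g4', ho, List.append_assoc, List.append_assoc] at e'
          have := List.append_cancel_left e'
          simp at this
          rw [g3, g3', g4, g4', this.1, ho, hi]
          simp
      obtain ⟨hl, hi'⟩ := ih key.1 key.2 (he.of_infix (List.suffix_cons _ _).isInfix)
        (he'.of_infix (List.suffix_cons _ _).isInfix) h2 h2'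
        ((step_items h1).nodup_iff.2 hn) ((step_items h1').nodup_iff.2 hn')
      refine ⟨by simp [hl], fun i => ?_⟩
      cases i with
      | zero => exact ⟨c, c', rfl, rfl, hi, ho⟩
      | succ i =>
        obtain ⟨e, e', q1, q2, q3⟩ := hi' i
        exact ⟨e, e', by rw [List.take_succ_cons, run_cons, h1, Option.bind_some, q1],
          by rw [List.take_succ_cons, run_cons, h1', Option.bind_some, q2], q3⟩

theorem crosses_color {w : List Op} {k l : ℕ} (h : Crosses w k l) : IsRed w k ↔ ¬ IsRed w l := by
  obtain ⟨h1, i, j, i', j', h2, h3, -⟩ := h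
  rw [isRed_iff h2.1, isRed_iff h3.1, isBlue_iff h2.1, isBlue_iff h3.1] at h1
  rw [isRed_iff h2.1, isRed_iff h3.1]
  rcases h1 with ⟨h1, h2⟩ | ⟨h1, h2⟩ <;> simp [h1, h2]

/-- Equal arches give equal crossing graphs, and in both words colours alternate along edges. An
earlier item in the same component lies in the common prefix, so has the same colour in both words;
the colours would then agree on the whole component. Hence the differing item is first in its
component, where standardness forbids blue. -/
theorem not_first_difference {w w' x r r' : List Op} (hw : OS w) (hw' : OS w')
    (hA : ∀ k i j, IsArch w k i j ↔ IsArch w' k i j) (hS : IsStandard w')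
    (e : w = x ++ .I1 :: r) (e' : w' = x ++ .I2 :: r') : False := by
  have hin : InputAt w (numItems x + 1) x.length := inputAt_of_split (b := false) hw e
  have hin' : InputAt w' (numItems x + 1) x.length := inputAt_of_split (b := true) hw' e'
  have hred : IsRed w (numItems x + 1) := (isRed_iff hin).2 (by simp [e])
  have hred' : ¬ IsRed w' (numItems x + 1) := fun h => by
    have := (isRed_iff hin').1 h
    simp [e'] at this
  have hk : numItems x + 1 ∈ Finset.Icc 1 (numItems w') := by
    rw [e', numItems_append, show numItems (.I2 :: r') = _ from numItems_inp true r',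
      Finset.mem_Icc]
    omega
  obtain ⟨i₀, j₀, hk₀⟩ := exists_isArch hw' hk
  obtain rfl := hk₀.1.unique hin'
  have hadj : ∀ a c, (archGraph w').Adj a c →
      ((IsRed w a ↔ ¬ IsRed w c) ∧ (IsRed w' a ↔ ¬ IsRed w' c)) := by
    intro a c hac
    obtain ⟨i, j, hc⟩ := exists_isArch_of_adj hac
    obtain ⟨i', j', ha⟩ := exists_isArch_of_adj hac.symm
    have hac' : (archGraph w).Adj a c := by
      rwa [archGraph_adj_iff hw ((hA _ _ _).2 ha) ((hA _ _ _).2 hc), ← archGraph_adj_iff hw' ha hc]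
    constructor
    · rcases (archGraph_adj.1 hac').2 with h | h <;> have := crosses_color h <;> tauto
    · rcases (archGraph_adj.1 hac).2 with h | h <;> have := crosses_color h <;> tauto
  refine hred' (hS _ hk fun l hl => ?_)
  by_contra hlt
  obtain ⟨i, j, hla⟩ := exists_isArch_of_reachable hk₀ hl
  have hil := (hla.lt_iff hw' hk₀).1 (by omega)
  have hP := reachable_induction (P := fun l => IsRed w l ↔ IsRed w' l) hl.symm ?_ ?_
  · exact hred' (hP.1 hred)
  · rw [isRed_iff ((hA _ _ _).2 hla).1, isRed_iff hla.1, e, e', List.getElem?_append_left hil,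
      List.getElem?_append_left hil]
  · intro a c _ hac ha
    have := hadj a c hac
    tauto

theorem exists_first_difference {w w' : List Op} (hl : w.length = w'.length) (hne : w ≠ w') :
    ∃ x o r o' r', w = x ++ o :: r ∧ w' = x ++ o' :: r' ∧ o ≠ o' := by
  induction w generalizing w' with
  | nil => exact absurd (List.length_eq_zero_iff.1 hl.symm).symm hne
  | cons o w ih =>
    cases w' with
    | nil => simp at hl
    | cons o' w' =>
      by_cases h : o = o'
      · subst h
        obtain ⟨x, p, r, p', r', rfl, rfl, h⟩ := ih (w' := w') (by simpa using hl)
          (fun h => hne (by rw [h]))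
        exact ⟨o :: x, p, r, p', r', rfl, rfl, h⟩
      · exact ⟨[], o, w, o', w', rfl, rfl, h⟩

theorem IsCanonical.eq_of_produces {n : ℕ} {π : Equiv.Perm (Fin n)} {w w' : List Op}
    (hw : IsCanonical w) (hw' : IsCanonical w') (h : Produces w π) (h' : Produces w' π) :
    w = w' := by
  have hn : (Config.init n).items.Nodup := by
    simp [Config.items, Config.init, List.nodup_range']
  obtain ⟨hl, htr⟩ := eager_trace rfl rfl hw.2.2 hw'.2.2 h h' hn hn
  have e1 := h.operationSequence.2
  have e2 := h'.operationSequence.2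
  have hcfg : ∀ i, ∃ d d', configAt w i = some d ∧ configAt w' i = some d' ∧
      d.input = d'.input ∧ d.output = d'.output := by
    simpa only [configAt, e1, e2] using htr
  have hA : ∀ k i j, IsArch w k i j ↔ IsArch w' k i j := by
    intro k i j
    obtain ⟨d, d', q1, q2, q3, q4⟩ := hcfg i
    obtain ⟨f, f', q5, q6, q7, q8⟩ := hcfg (i + 1)
    obtain ⟨g, g', q9, q10, q11, q12⟩ := hcfg j
    obtain ⟨p, p', q13, q14, q15, q16⟩ := hcfg (j + 1)
    simp only [IsArch, InputAt, OutputAt, q1, q2, q5, q6, q9, q10, q13, q14, Option.some.injEq,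
      exists_and_left, exists_eq_left', q3, q7, q12, q16]
  by_contra hne
  obtain ⟨x, o, r, o', r', rfl, rfl, ho⟩ := exists_first_difference hl hne
  obtain ⟨d, d', q1, q2, q3, q4⟩ := htr (x.length + 1)
  rw [show (x ++ o :: r).take (x.length + 1) = x ++ [o] by simp [List.take_append]] at q1
  rw [show (x ++ o' :: r').take (x.length + 1) = x ++ [o'] by simp [List.take_append]] at q2
  obtain ⟨c, hc, s1⟩ := run_append_eq_some.1 q1
  obtain ⟨c', hc', s2⟩ := run_append_eq_some.1 q2
  obtain rfl : c = c' := by rw [hc] at hc'; simpa using hc'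
  rw [run_singleton] at s1 s2
  obtain ⟨b, rfl | rfl⟩ := op_cases o <;> obtain ⟨b', rfl | rfl⟩ := op_cases o'
  · cases b <;> cases b'
    · exact ho rfl
    · exact not_first_difference hw.1 hw'.1 hA hw'.2.1 rfl rfl
    · exact not_first_difference hw'.1 hw.1 (fun k i j => (hA k i j).symm) hw.2.1 rfl rfl
    · exact ho rfl
  · obtain ⟨k, -, -, -, g⟩ := step_inp.1 s1
    obtain ⟨k', -, -, -, g'⟩ := step_out.1 s2
    simp [g, g'] at q4
  · obtain ⟨k, -, -, -, g⟩ := step_out.1 s1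
    obtain ⟨k', -, -, -, g'⟩ := step_inp.1 s2
    simp [g, g'] at q4
  · obtain ⟨k, g1, -, -, g⟩ := step_out.1 s1
    obtain ⟨k', g1', -, -, g'⟩ := step_out.1 s2
    -- Outputs from different stacks would release the same item, which would then lie in both
    -- stacks.
    obtain rfl : b' = !b := by cases b <;> cases b' <;> simp_all
    obtain rfl : k = k' := by simpa [g, g'] using q4
    have hnd := (run_items hc).nodup_iff.2 hn
    rw [(c.items_perm b).nodup_iff, g1, g1'] at hnd
    simp [List.nodup_append] at hnd

/-- Permutations are counted by the canonical sequences that produce them. -/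
theorem card_perm_eq {q : List Op → Prop} (hq : ∀ w, q w → IsCanonical w) (n : ℕ) :
    Nat.card {π : Equiv.Perm (Fin n) // ∃ w, q w ∧ Produces w π} =
      Nat.card {w : List Op // q w ∧ numItems w = n} := by
  refine Nat.card_eq_of_bijective
    (fun π => ⟨π.2.choose, π.2.choose_spec.1, π.2.choose_spec.2.operationSequence.2⟩) ⟨?_, ?_⟩
  · intro π π' h
    have h1 := π.2.choose_spec.2
    have h2 := π'.2.choose_spec.2
    have h3 : π.2.choose = π'.2.choose := congrArg Subtype.val h
    rw [h3] at h1
    have := Option.some.inj (h1.symm.trans h2)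
    simp at this
    exact Subtype.ext (Equiv.ext fun i => Fin.ext (Nat.succ_injective (congrFun this i)))
  · rintro ⟨w, hw, hn⟩
    obtain ⟨π, hπ⟩ := exists_produces (hq w hw).1 hn
    have h : ∃ w, q w ∧ Produces w π := ⟨w, hw, hπ⟩
    exact ⟨⟨π, h⟩, Subtype.ext
      ((hq _ h.choose_spec.1).eq_of_produces (hq w hw) h.choose_spec.2 hπ)⟩

theorem card_achievable (n : ℕ) : Nat.card {π : Equiv.Perm (Fin n) // IsAchievable π} =
    Nat.card {w : List Op // IsCanonical w ∧ numItems w = n} := by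
  rw [← card_perm_eq (fun _ h => h)]
  have : ∀ π : Equiv.Perm (Fin n), IsAchievable π ↔ ∃ w, IsCanonical w ∧ Produces w π :=
    fun π => ⟨IsAchievable.exists_canonical, fun ⟨w, _, h⟩ => ⟨w, h⟩⟩
  simp only [this]

theorem card_primitive (n : ℕ) : Nat.card {π : Equiv.Perm (Fin n) // IsPrimitivePerm π} =
    Nat.card {w : List Op // (IsCanonical w ∧ IsPrimitive w) ∧ numItems w = n} := by
  rw [← card_perm_eq (fun _ h => h.1)]
  simp only [IsPrimitivePerm, and_assoc]

/-! Corners of operation sequences. -/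

/-- The letter `o` is an input to a stack, and the next one is an output from the other stack. -/
def IsCorner (o : Op) (o' : Option Op) : Prop :=
  o = .I1 ∧ o' = some .O2 ∨ o = .I2 ∧ o' = some .O1

instance (o : Op) (o' : Option Op) : Decidable (IsCorner o o') := by
  unfold IsCorner; infer_instance

/-- The number of factors `I₁ O₂` and `I₂ O₁`. -/
def cornerCount : List Op → ℕ
  | [] => 0
  | o :: w => (if IsCorner o w.head? then 1 else 0) + cornerCount w

theorem outputsEagerly_iff_cornerCount {w : List Op} :
    OutputsEagerly w ↔ cornerCount w = 0 := by
  induction w with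
  | nil => simp [OutputsEagerly, cornerCount]
  | cons o w ih =>
    unfold OutputsEagerly at ih ⊢
    rw [List.infix_cons_iff, List.infix_cons_iff, List.cons_prefix_cons, List.cons_prefix_cons]
    have h1 : ∀ p : Op, [p] <+: w ↔ w.head? = some p := by
      intro p
      cases w <;> simp [eq_comm]
    rw [h1, h1, cornerCount, Nat.add_eq_zero_iff, ← ih]
    unfold IsCorner
    split_ifs <;> grind

theorem not_isCorner_out (b : Bool) (o' : Option Op) : ¬ IsCorner (out b) o' := by
  cases b <;> simp [IsCorner, out]

theorem not_isCorner_inp (o : Op) (b : Bool) : ¬ IsCorner o (some (inp b)) := by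
  cases b <;> simp [IsCorner, inp]

/-- A non-empty operation sequence ends with an output, which never begins a corner. -/
theorem cornerCount_append {u : List Op} (hu : OS u) (v : List Op) :
    cornerCount (u ++ v) = cornerCount u + cornerCount v := by
  rcases List.eq_nil_or_concat' u with rfl | ⟨w, o, rfl⟩
  · simp [cornerCount]
  obtain ⟨b, rfl⟩ := operationSequence_concat hu
  clear hu
  induction w with
  | nil => simp [cornerCount, not_isCorner_out]
  | cons o w ih =>
    have : (w ++ [out b] ++ v).head? = (w ++ [out b]).head? := by cases w <;> simp
    simp only [List.cons_append, cornerCount]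
    rw [this, ih, add_assoc]

theorem cornerCount_cons_append {s : List Op} (hs : OS s) (hne : s ≠ []) (o : Op) (v : List Op) :
    cornerCount (o :: (s ++ v)) = cornerCount s + cornerCount v := by
  obtain ⟨o', s, rfl⟩ := List.exists_cons_of_ne_nil hne
  obtain ⟨b, rfl⟩ := operationSequence_cons hs
  rw [cornerCount, cornerCount_append hs]
  simp [not_isCorner_inp]

theorem isCorner_flip {o : Op} {o' : Option Op} :
    IsCorner o.flip (o'.map Op.flip) ↔ IsCorner o o' := by
  cases o <;> rcases o' with _ | o' <;> simp [IsCorner, Op.flip] <;> cases o' <;> simp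

/-! Canonical and primitive sequences. -/

theorem isCanonical_iff {w : List Op} :
    IsCanonical w ↔ (OS w ∧ FactorStandard w) ∧ cornerCount w = 0 := by
  rw [IsCanonical, outputsEagerly_iff_cornerCount, and_assoc]
  exact and_congr_right fun h => by rw [isStandard_iff h]

theorem isCanonical_append {u v : List Op} (hu : OS u) :
    IsCanonical (u ++ v) ↔ IsCanonical u ∧ IsCanonical v := by
  simp only [isCanonical_iff, operationSequence_append_left hu, factorStandard_append hu,
    cornerCount_append hu]
  have : cornerCount u + cornerCount v = 0 ↔ cornerCount u = 0 ∧ cornerCount v = 0 := by omega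
  tauto

theorem isCanonical_nil : IsCanonical [] := by
  rw [isCanonical_iff]
  refine ⟨⟨operationSequence_nil, ?_⟩, rfl⟩
  intro y hy _
  simp [List.infix_nil.1 hy]

theorem exists_primitive_prefix {w : List Op} (hw : OS w) (hne : w ≠ []) :
    ∃ p c, IsPrimitive p ∧ w = p ++ c := by
  induction h : w.length using Nat.strong_induction_on generalizing w with
  | _ n ih =>
    by_cases hp : IsPrimitive w
    · exact ⟨w, [], hp, by simp⟩
    · simp only [IsPrimitive, hw, hne, ne_eq, not_false_eq_true, true_and] at hp
      push Not at hp
      obtain ⟨u, v, hu, hv, rfl, hu', hv'⟩ := hp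
      have hpos := List.length_pos_iff_ne_nil.2 hv'
      obtain ⟨p, c, hp, rfl⟩ := ih u.length (by simp at h; omega) hu hu' rfl
      exact ⟨p, c ++ v, hp, by simp⟩

/-- One of `p`, `p'` extends the other by an operation sequence, which primitivity forces to be
empty. -/
theorem primitive_prefix_unique {p p' c c' : List Op} (hp : IsPrimitive p) (hp' : IsPrimitive p')
    (h : p ++ c = p' ++ c') : p = p' ∧ c = c' := by
  rcases List.append_eq_append_iff.1 h with ⟨y, h1, h2⟩ | ⟨y, h1, h2⟩
  · have hy := (operationSequence_append_left hp.1 y).1 (h1 ▸ hp'.1)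
    rcases hp'.2.2 p y hp.1 hy h1 with h3 | rfl
    · exact absurd h3 hp.2.1
    · exact ⟨by simpa using h1.symm, h2⟩
  · have hy := (operationSequence_append_left hp'.1 y).1 (h1 ▸ hp.1)
    rcases hp.2.2 p' y hp'.1 hy h1 with h3 | rfl
    · exact absurd h3 hp'.2.1
    · exact ⟨by simpa using h1, h2.symm⟩

/-! Formal sums of power series. -/

open PowerSeries
open scoped PowerSeries.WithPiTopology

/-- Up to any power of `X`, the family has finitely many non-zero terms. -/
def FinitelySupported {ι : Type*} (f : ι → PowerSeries ℚ) : Prop :=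
  ∀ n, {i | ¬ (X : PowerSeries ℚ) ^ n ∣ f i}.Finite

theorem FinitelySupported.summable {ι : Type*} {f : ι → PowerSeries ℚ}
    (hf : FinitelySupported f) : Summable f := by
  rw [WithPiTopology.summable_iff_summable_coeff]
  intro n
  refine summable_of_hasFiniteSupport ((hf (n + 1)).subset fun i hi hdvd => hi ?_)
  exact X_pow_dvd_iff.1 hdvd n (Nat.lt_succ_self n)

theorem FinitelySupported.mul {ι κ : Type*} {f : ι → PowerSeries ℚ} {g : κ → PowerSeries ℚ}
    (hf : FinitelySupported f) (hg : FinitelySupported g) :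
    FinitelySupported fun p : ι × κ => f p.1 * g p.2 := fun n =>
  ((hf n).prod (hg n)).subset fun _ hp =>
    ⟨fun h => hp (h.mul_right _), fun h => hp (h.mul_left _)⟩

theorem FinitelySupported.of_dvd {ι : Type*} {f : ι → PowerSeries ℚ} {l : ι → ℕ}
    (h : ∀ i, X ^ l i ∣ f i) (hl : ∀ n, {i | l i ≤ n}.Finite) : FinitelySupported f := fun n =>
  (hl n).subset fun i hi => by
    by_contra hlt
    exact hi ((pow_dvd_pow X (by simp at hlt; omega)).trans (h i))

/-- Congruence modulo `X^k` concerns the coefficients below `k`, and these are summed separately.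
Both `X`-adic uniqueness arguments rest on this. -/
theorem dvd_of_hasSum {ι : Type*} {f g : ι → PowerSeries ℚ} {A B : PowerSeries ℚ} {k : ℕ}
    (hf : HasSum f A) (hg : HasSum g B) (h : ∀ i, X ^ k ∣ f i - g i) : X ^ k ∣ A - B := by
  rw [X_pow_dvd_iff]
  intro m hm
  have h1 := (WithPiTopology.hasSum_iff_hasSum_coeff ℚ).1 (hf.sub hg) m
  have h2 : (fun i => coeff m (f i - g i)) = fun _ => 0 :=
    funext fun i => X_pow_dvd_iff.1 (h i) m hm
  rw [h2] at h1
  exact h1.unique hasSum_zero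

instance : Finite Op :=
  Finite.of_injective (fun o : Op => (o.rank : ZMod 4)) (by
    intro a b; cases a <;> cases b <;> simp [Op.rank] <;> decide)

theorem finite_numItems_le {P : List Op → Prop} (hP : ∀ w, P w → OS w) (n : ℕ) :
    {w : {w // P w} | numItems w.1 ≤ n}.Finite := by
  refine ((List.finite_length_le Op (2 * n)).preimage Subtype.val_injective.injOn).subset ?_
  intro w hw
  have := length_of_operationSequence (hP _ w.2)
  simp at hw ⊢
  omega

/-- The weight of a word. -/
def weight (a u : PowerSeries ℚ) (w : List Op) : PowerSeries ℚ :=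
  a ^ cornerCount w * u ^ numItems w

theorem hasSum_card {q : List Op → Prop} (hq : ∀ w, q w → OS w) :
    HasSum (fun w : {w // q w} => (X : PowerSeries ℚ) ^ numItems w.1)
      (PowerSeries.mk fun n => (Nat.card {w // q w ∧ numItems w = n} : ℚ)) := by
  rw [WithPiTopology.hasSum_iff_hasSum_coeff]
  intro n
  have hfin : {w : {w // q w} | numItems w.1 = n}.Finite :=
    (finite_numItems_le hq n).subset fun w hw => le_of_eq hw
  have h1 : HasSum (fun w : {w // q w} => coeff n ((X : PowerSeries ℚ) ^ numItems w.1))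
      (∑ w ∈ hfin.toFinset, coeff n ((X : PowerSeries ℚ) ^ numItems w.1)) := by
    refine hasSum_sum_of_ne_finset_zero fun w hw => ?_
    rw [coeff_X_pow, if_neg]
    simpa [eq_comm] using hw
  suffices h2 : (Nat.card {w // q w ∧ numItems w = n} : ℚ) =
      ∑ w ∈ hfin.toFinset, coeff n ((X : PowerSeries ℚ) ^ numItems w.1) by
    rw [coeff_mk, h2]
    exact h1
  rw [Finset.sum_congr rfl (g := fun _ => (1 : ℚ)), Finset.sum_const, nsmul_one,
    ← Set.ncard_eq_toFinset_card _ hfin]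
  · norm_cast
    rw [← Nat.card_coe_set_eq]
    exact Nat.card_congr (Equiv.subtypeSubtypeEquivSubtypeInter q fun w => numItems w = n).symm
  · intro w hw
    simp at hw
    simp [coeff_X_pow, hw]

theorem hasSum_achievableSeries : HasSum (fun w : {w // IsCanonical w} =>
    (X : PowerSeries ℚ) ^ numItems w.1) achievableSeries := by
  simpa only [achievableSeries, card_achievable] using hasSum_card fun w (h : IsCanonical w) => h.1

theorem hasSum_primitiveSeries : HasSum (fun w : {w // IsCanonical w ∧ IsPrimitive w} =>
    (X : PowerSeries ℚ) ^ numItems w.1) primitiveSeries := by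
  simpa only [primitiveSeries, card_primitive] using
    hasSum_card fun w (h : IsCanonical w ∧ IsPrimitive w) => h.1.1

theorem X_pow_numItems_finitelySupported {P : List Op → Prop} (hP : ∀ w, P w → OS w) :
    FinitelySupported fun w : {w // P w} => (X : PowerSeries ℚ) ^ numItems w.1 :=
  .of_dvd (fun _ => dvd_rfl) (finite_numItems_le hP)

/-- Removal of the empty word from a sum over words. -/
theorem hasSum_ne_nil {P : List Op → Prop} (h0 : P []) {f : List Op → PowerSeries ℚ}
    {A : PowerSeries ℚ} (h : HasSum (fun w : {w // P w} => f w) A) :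
    HasSum (fun w : {w // P w ∧ w ≠ []} => f w) (A - f []) := by
  have h1 := hasSum_subtype_iff_indicator (s := {w | P w}) (f := f) |>.1 h
  refine hasSum_subtype_iff_indicator (s := {w | P w ∧ w ≠ []}) (f := f) |>.2 ?_
  classical
  have h2 := h1.sub (hasSum_ite_eq [] (f []))
  refine (congrArg (fun g => HasSum g _) (funext fun w => ?_)).mp h2
  by_cases hw : w = []
  · subst hw
    simp [h0]
  · simp [Set.indicator, hw]

/-- A non-empty canonical sequence is its first primitive factor followed by an arbitrary canonical
sequence, because being canonical splits over such concatenations. -/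
theorem achievableSeries_sub_one :
    achievableSeries - 1 = primitiveSeries * achievableSeries := by
  have h1 := hasSum_ne_nil isCanonical_nil hasSum_achievableSeries
    (f := fun w => (X : PowerSeries ℚ) ^ numItems w)
  have h2 := hasSum_primitiveSeries.mul hasSum_achievableSeries
    ((X_pow_numItems_finitelySupported
      fun w (h : IsCanonical w ∧ IsPrimitive w) => h.1.1).mul
      (X_pow_numItems_finitelySupported fun w (h : IsCanonical w) => h.1)).summable
  let e : {w // IsCanonical w ∧ IsPrimitive w} × {w // IsCanonical w} ≃
      {w // IsCanonical w ∧ w ≠ []} := Equiv.ofBijective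
    (fun p => ⟨p.1.1 ++ p.2.1, (isCanonical_append p.1.2.1.1).2 ⟨p.1.2.1, p.2.2⟩, by
      simp [p.1.2.2.2.1]⟩) (by
    constructor
    · rintro ⟨⟨p, hp⟩, c, hc⟩ ⟨⟨p', hp'⟩, c', hc'⟩ h
      obtain ⟨rfl, rfl⟩ := primitive_prefix_unique hp.2 hp'.2 (congrArg Subtype.val h)
      rfl
    · rintro ⟨w, hw, hne⟩
      obtain ⟨p, c, hp, rfl⟩ := exists_primitive_prefix hw.1 hne
      have := (isCanonical_append hp.1).1 hw
      exact ⟨⟨⟨p, this.1, hp⟩, c, this.2⟩, rfl⟩)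
  have h3 := e.hasSum_iff.2 h1
  have h4 := h3.unique ((congrArg (fun g => HasSum g _) (funext fun p => ?_)).mp h2)
  · simpa using h4
  · change _ = (X : PowerSeries ℚ) ^ numItems (p.1.1 ++ p.2.1)
    rw [numItems_append, pow_add]

/-! Sums over all words obtained by insertion in a given word. -/

/-- The contribution of a word inserted after a letter, which is the first letter of a corner if
`k` holds. -/
def slotWeight (a u : PowerSeries ℚ) (k : Prop) [Decidable k] (s : List Op) : PowerSeries ℚ :=
  if s = [] then (if k then a else 1) else weight a u s

/-- The product of the series `x` for each corner and `y` for each other position. -/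
def slotProd (x y : PowerSeries ℚ) : List Op → PowerSeries ℚ
  | [] => 1
  | o :: c => (if IsCorner o c.head? then x else y) * slotProd x y c

theorem weight_cons_append (a u : PowerSeries ℚ) (o : Op) {s : List Op} (hs : OS s)
    (v : List Op) : weight a u (o :: (s ++ v)) =
      u ^ numItems [o] * (slotWeight a u (IsCorner o v.head?) s * weight a u v) := by
  rw [weight, numItems_cons, pow_add, slotWeight]
  by_cases h : s = []
  · subst h
    simp only [List.nil_append, cornerCount, weight, pow_add, if_true]
    split_ifs <;> ring
  · rw [cornerCount_cons_append hs h, if_neg h, numItems_append, weight, weight, pow_add, pow_add]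
    ring

theorem weight_nil (a u : PowerSeries ℚ) : weight a u [] = 1 := by simp [weight, cornerCount]

/-- Only the empty insertion sees the corner: its contribution changes from `1` to `a`. -/
theorem hasSum_slotWeight {P : List Op → Prop} (h0 : P []) {a u G : PowerSeries ℚ}
    (hG : HasSum (fun s : {s // P s} => weight a u s) G) (k : Prop) [Decidable k] :
    HasSum (fun s : {s // P s} => slotWeight a u k s) (if k then a + G - 1 else G) := by
  have h := hG.add (hasSum_ite_eq (⟨[], h0⟩ : {s // P s}) (if k then a - 1 else 0))
  have e : G + (if k then a - 1 else 0) = if k then a + G - 1 else G := by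
    split_ifs <;> ring
  rw [e] at h
  refine (congrArg (fun g => HasSum g _) (funext fun s => ?_)).mp h
  rw [slotWeight]
  by_cases hs : s.1 = []
  · rw [if_pos (Subtype.ext hs), if_pos hs, hs, weight_nil]
    split_ifs <;> ring
  · rw [if_neg (fun h => hs (congrArg Subtype.val h)), if_neg hs, add_zero]

theorem slotWeight_finitelySupported {P : List Op → Prop} (hP : ∀ w, P w → OS w)
    {a u : PowerSeries ℚ} (hu : X ∣ u) (k : Prop) [Decidable k] :
    FinitelySupported fun s : {s // P s} => slotWeight a u k s := by
  refine .of_dvd (l := fun s => numItems s.1) (fun s => ?_) (finite_numItems_le hP)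
  rw [slotWeight]
  by_cases hs : s.1 = []
  · simp [hs]
  · rw [if_neg hs]
    exact (pow_dvd_pow_of_dvd hu _).mul_left _

/-- The word obtained by inserting words of a given class. -/
def flatSub {P : List Op → Prop} (L : List (Op × {s // P s})) : List Op :=
  flat (L.map (Prod.map id Subtype.val))

theorem flatSub_cons {P : List Op → Prop} (o : Op) (s : {s // P s})
    (L : List (Op × {s // P s})) : flatSub ((o, s) :: L) = o :: (s.1 ++ flatSub L) := by
  simp [flatSub]

theorem head?_flatSub {P : List Op → Prop} (L : List (Op × {s // P s})) :
    (flatSub L).head? = (L.map Prod.fst).head? := by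
  cases L with
  | nil => rfl
  | cons p L => rfl

/-- The first item of the list, and the others. -/
def consEquiv (P : List Op → Prop) (o : Op) (c : List Op) :
    {s // P s} × {L : List (Op × {s // P s}) // L.map Prod.fst = c} ≃
      {L : List (Op × {s // P s}) // L.map Prod.fst = o :: c} where
  toFun p := ⟨(o, p.1) :: p.2.1, by simp [p.2.2]⟩
  invFun L := (((L.1.head (by rintro h; have := L.2; simp [h] at this)).2),
    ⟨L.1.tail, by rw [List.map_tail, L.2]; rfl⟩)
  left_inv p := rfl
  right_inv := by
    rintro ⟨_ | ⟨⟨o', s⟩, L⟩, h⟩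
    · simp at h
    · simp at h
      simp [h.1]

theorem hasSum_insertions {P : List Op → Prop} (hP : ∀ w, P w → OS w) (h0 : P [])
    {a u G : PowerSeries ℚ} (hu : X ∣ u) (hG : HasSum (fun s : {s // P s} => weight a u s) G)
    (c : List Op) :
    FinitelySupported (fun L : {L : List (Op × {s // P s}) // L.map Prod.fst = c} =>
      weight a u (flatSub L.1)) ∧
    HasSum (fun L : {L : List (Op × {s // P s}) // L.map Prod.fst = c} =>
      weight a u (flatSub L.1)) (u ^ numItems c * slotProd (a + G - 1) G c) := by
  induction c with
  | nil =>
    have : Unique {L : List (Op × {s // P s}) // L.map Prod.fst = []} :=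
      ⟨⟨⟨[], rfl⟩⟩, fun L => Subtype.ext (List.map_eq_nil_iff.1 L.2)⟩
    refine ⟨fun n => Set.toFinite _, ?_⟩
    have h := hasSum_unique (fun L : {L : List (Op × {s // P s}) // L.map Prod.fst = []} =>
      weight a u (flatSub L.1))
    have e : (default : {L : List (Op × {s // P s}) // L.map Prod.fst = []}).1 = [] :=
      List.map_eq_nil_iff.1
      (default : {L : List (Op × {s // P s}) // L.map Prod.fst = []}).2
    rw [e] at h
    simpa [slotProd, flatSub, weight_nil] using h
  | cons o c ih =>
    have hs := slotWeight_finitelySupported hP (a := a) hu (IsCorner o c.head?)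
    have hf := hs.mul ih.1
    have h1 := ((hasSum_slotWeight h0 hG (IsCorner o c.head?)).mul ih.2 hf.summable).mul_left
      (u ^ numItems [o])
    have hterm : ∀ p, weight a u (flatSub (consEquiv P o c p).1) = u ^ numItems [o] *
        (slotWeight a u (IsCorner o c.head?) p.1.1 * weight a u (flatSub p.2.1)) := by
      intro p
      have : flatSub (consEquiv P o c p).1 = o :: (p.1.1 ++ flatSub p.2.1) := flatSub_cons _ _ _
      rw [this, weight_cons_append a u o (hP _ p.1.2)]
      have h2 : (flatSub p.2.1).head? = c.head? := by rw [head?_flatSub, p.2.2]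
      rw [h2]
    constructor
    · intro n
      have := (hf n).image (consEquiv P o c)
      refine this.subset fun L hL => ?_
      refine ⟨(consEquiv P o c).symm L, fun h => hL ?_, by simp⟩
      change X ^ n ∣ weight a u (flatSub L.1)
      rw [← (consEquiv P o c).apply_symm_apply L, hterm]
      exact h.mul_left _
    · rw [← (consEquiv P o c).hasSum_iff]
      have e : u ^ numItems (o :: c) * slotProd (a + G - 1) G (o :: c) = u ^ numItems [o] *
          ((if IsCorner o c.head? then a + G - 1 else G) *
            (u ^ numItems c * slotProd (a + G - 1) G c)) := by
        rw [numItems_cons, pow_add, slotProd]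
        ring
      rw [e]
      exact (congrArg (fun g => HasSum g _) (funext fun p => (hterm p).symm)).mp h1

theorem map_subtype_mem {P : List Op → Prop} {L : List (Op × {s // P s})} :
    ∀ p ∈ L.map (Prod.map id Subtype.val), P p.2 := by
  intro p hp
  obtain ⟨q, -, rfl⟩ := List.mem_map.1 hp
  exact q.2.2

theorem exists_map_subtype {P : List Op → Prop} {L : List (Op × List Op)} (h : ∀ p ∈ L, P p.2) :
    ∃ M : List (Op × {s // P s}), M.map (Prod.map id Subtype.val) = L := by
  induction L with
  | nil => exact ⟨[], rfl⟩
  | cons p L ih =>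
    obtain ⟨M, rfl⟩ := ih fun p hp => h p (by simp [hp])
    exact ⟨(p.1, ⟨p.2, h p (by simp)⟩) :: M, rfl⟩

/-- The equation for the generating function of a class of operation sequences that is described
by the irreducible sequences `c` and the insertions in `c`. -/
theorem hasSum_irreducible {P C : List Op → Prop} (hP : ∀ w, P w → OS w) (h0 : P [])
    (hC : ∀ c, C c → IsIrreducible c)
    (hflat : ∀ L : List (Op × List Op), IsIrreducible (L.map Prod.fst) → (∀ p ∈ L, OS p.2) →
      (P (flat L) ↔ C (L.map Prod.fst) ∧ ∀ p ∈ L, P p.2))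
    {a u G : PowerSeries ℚ} (hu : X ∣ u) (hG : HasSum (fun s : {s // P s} => weight a u s) G) :
    HasSum (fun c : {c // C c} => u ^ numItems c.1 * slotProd (a + G - 1) G c) (G - 1) := by
  have h1 := hasSum_ne_nil h0 hG
  rw [weight_nil] at h1
  have hfst : ∀ L : List (Op × {s // P s}),
      (L.map (Prod.map id Subtype.val)).map Prod.fst = L.map Prod.fst := by
    intro L
    rw [List.map_map]
    rfl
  let f : (Σ c : {c // C c}, {L : List (Op × {s // P s}) // L.map Prod.fst = c}) →
      {w // P w ∧ w ≠ []} := fun p => ⟨flatSub p.2.1, by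
    obtain ⟨⟨c, hc⟩, L, hL⟩ := p
    replace hL : L.map Prod.fst = c := hL
    refine ⟨(hflat _ ?_ fun p hp => hP _ (map_subtype_mem p hp)).2 ⟨?_, map_subtype_mem⟩, ?_⟩
    · rw [hfst, hL]; exact hC _ hc
    · rw [hfst, hL]; exact hc
    · cases L with
      | nil => exact absurd hL.symm (hC _ hc).2.1
      | cons p L => simp [flatSub, flat]⟩
  have hf : Function.Bijective f := by
    constructor
    · rintro ⟨⟨c, hc⟩, L, hL⟩ ⟨⟨c', hc'⟩, L', hL'⟩ h
      replace hL : L.map Prod.fst = c := hL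
      replace hL' : L'.map Prod.fst = c' := hL'
      have h2 : L.map (Prod.map id Subtype.val) = L'.map (Prod.map id Subtype.val) :=
        flat_injective_of_irreducible (by rw [hfst, hL]; exact hC _ hc)
          (by rw [hfst, hL']; exact hC _ hc')
          (fun p hp => hP _ (map_subtype_mem p hp)) (fun p hp => hP _ (map_subtype_mem p hp))
          (congrArg Subtype.val h)
      obtain rfl : L = L' := List.map_injective_iff.2
        (Function.Injective.prodMap Function.injective_id Subtype.val_injective) h2
      obtain rfl : c = c' := hL.symm.trans hL'
      rfl
    · rintro ⟨w, hw, hne⟩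
      obtain ⟨L, hL, hLO, rfl⟩ := exists_flat_of_ne_nil (hP _ hw) hne
      obtain ⟨hc, hLP⟩ := (hflat L hL hLO).1 hw
      obtain ⟨M, rfl⟩ := exists_map_subtype hLP
      exact ⟨⟨⟨M.map Prod.fst, by rw [← hfst]; exact hc⟩, M, rfl⟩, rfl⟩
  have h2 := (Equiv.ofBijective f hf).hasSum_iff.2 h1
  -- The sum over words is regrouped by skeleton, and the inner sums over insertions are known.
  exact h2.sigma fun c => (hasSum_insertions hP h0 hu hG c.1).2

/-! The two cases of interest. -/

theorem hasSum_irreducible_all {a u G : PowerSeries ℚ} (hu : X ∣ u)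
    (hG : HasSum (fun s : {s // OS s} => weight a u s) G) :
    HasSum (fun c : {c // IsIrreducible c} => u ^ numItems c.1 * slotProd (a + G - 1) G c)
      (G - 1) :=
  hasSum_irreducible (fun _ h => h) operationSequence_nil (fun _ h => h)
    (fun _ hc hL => ⟨fun _ => ⟨hc, hL⟩, fun _ => operationSequence_flat_of_irreducible hc hL⟩)
    hu hG

theorem indicator_setOf (p : List Op → Prop) [DecidablePred p] (f : List Op → PowerSeries ℚ)
    (w : List Op) : Set.indicator {w | p w} f w = if p w then f w else 0 :=
  Set.indicator_apply _ _ _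

/-- Since `0 ^ 0 = 1`, setting `a = 0` keeps exactly the words without corner, that is, the eager
ones. -/
theorem hasSum_standard : HasSum (fun w : {w // OS w ∧ FactorStandard w} => weight 0 X w)
    achievableSeries := by
  have h1 := (hasSum_subtype_iff_indicator (s := {w | IsCanonical w})
    (f := fun w => (X : PowerSeries ℚ) ^ numItems w)).1 hasSum_achievableSeries
  refine (hasSum_subtype_iff_indicator (s := {w | OS w ∧ FactorStandard w})
    (f := weight 0 X)).2 ?_
  refine (congrArg (fun g => HasSum g _) (funext fun w => ?_)).mp h1
  classical
  rw [indicator_setOf, indicator_setOf, isCanonical_iff, weight]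
  by_cases h : OS w ∧ FactorStandard w <;> by_cases h' : cornerCount w = 0 <;> simp [h, h']

theorem hasSum_irreducible_red :
    HasSum (fun c : {c // IsIrreducible c ∧ c.head? = some .I1} =>
      (X : PowerSeries ℚ) ^ numItems c.1 * slotProd (achievableSeries - 1) achievableSeries c)
      (achievableSeries - 1) := by
  have h := hasSum_irreducible (P := fun w => OS w ∧ FactorStandard w)
    (C := fun c => IsIrreducible c ∧ c.head? = some .I1) (fun _ h => h.1)
    (isCanonical_iff.1 isCanonical_nil).1 (fun _ h => h.1) ?_ dvd_rfl hasSum_standard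
  · simpa only [zero_add] using h
  · intro L hc hL
    rw [factorStandard_flat hc hL]
    have := operationSequence_flat_of_irreducible hc hL
    grind

theorem slotProd_map_flip (x y : PowerSeries ℚ) (c : List Op) :
    slotProd x y (c.map Op.flip) = slotProd x y c := by
  induction c with
  | nil => rfl
  | cons o c ih => simp [slotProd, ih, isCorner_flip]

theorem slotProd_smul (r x y : PowerSeries ℚ) (c : List Op) :
    slotProd (r * x) (r * y) c = r ^ c.length * slotProd x y c := by
  induction c with
  | nil => simp [slotProd]
  | cons o c ih =>
    rw [slotProd, slotProd, ih, List.length_cons, pow_succ]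
    split_ifs <;> ring

/-- The irreducible sequences that start with either input, together. -/
theorem hasSum_irreducible_both :
    HasSum (fun c : {c // IsIrreducible c} =>
      (X : PowerSeries ℚ) ^ numItems c.1 * slotProd (achievableSeries - 1) achievableSeries c)
      (2 * (achievableSeries - 1)) := by
  set f : List Op → PowerSeries ℚ := fun c =>
    X ^ numItems c * slotProd (achievableSeries - 1) achievableSeries c with hf
  have h1 := (hasSum_subtype_iff_indicator
    (s := {c | IsIrreducible c ∧ c.head? = some .I1}) (f := f)).1 hasSum_irreducible_red
  let e : List Op ≃ List Op := ⟨List.map Op.flip, List.map Op.flip, fun w => by simp,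
    fun w => by simp⟩
  have h2 := h1.add (e.hasSum_iff.2 h1)
  rw [← two_mul] at h2
  refine (hasSum_subtype_iff_indicator (s := {c | IsIrreducible c}) (f := f)).2 ?_
  refine (congrArg (fun g => HasSum g _) (funext fun c => ?_)).mp h2
  have hI : IsIrreducible (c.map Op.flip) ↔ IsIrreducible c :=
    ⟨fun h => by simpa using h.map_flip, fun h => h.map_flip⟩
  have hfe : f (e c) = f c := by
    simp only [hf, e, Equiv.coe_fn_mk, numItems_map_flip, slotProd_map_flip]
  classical
  rw [Function.comp_apply, indicator_setOf, indicator_setOf, indicator_setOf, hfe]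
  simp only [e, Equiv.coe_fn_mk, hI]
  by_cases hc : IsIrreducible c
  · obtain ⟨o, c, rfl⟩ := List.exists_cons_of_ne_nil hc.2.1
    obtain ⟨b, rfl⟩ := operationSequence_cons hc.1
    simp only [hc, true_and]
    cases b <;> simp [inp, Op.flip]
  · simp [hc]

/-! ### Uniqueness of the solution of the equation over irreducible sequences. -/

theorem slotProd_dvd_sub {a x y : PowerSeries ℚ} {k : ℕ} (h : X ^ k ∣ x - y) (c : List Op) :
    X ^ k ∣ slotProd (a + x - 1) x c - slotProd (a + y - 1) y c := by
  induction c with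
  | nil => simp [slotProd]
  | cons o c ih =>
    simp only [slotProd]
    have h2 : ∀ p q r s : PowerSeries ℚ, X ^ k ∣ p - q → X ^ k ∣ r - s →
        X ^ k ∣ p * r - q * s := by
      intro p q r s h1 h2
      rw [show p * r - q * s = (p - q) * r + q * (r - s) by ring]
      exact dvd_add (h1.mul_right _) (h2.mul_left _)
    refine h2 _ _ _ _ ?_ ih
    split_ifs
    · simpa using h
    · exact h

theorem eq_of_forall_X_pow_dvd {x y : PowerSeries ℚ} (h : ∀ k, X ^ k ∣ x - y) : x = y := by
  rw [← sub_eq_zero]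
  ext n
  exact X_pow_dvd_iff.1 (h (n + 1)) n (Nat.lt_succ_self n)

theorem IsIrreducible.numItems_pos {c : List Op} (hc : IsIrreducible c) : 1 ≤ numItems c := by
  have := length_of_operationSequence hc.1
  have := List.length_pos_iff_ne_nil.2 hc.2.1
  omega

/-- The right-hand side is an `X`-adic contraction: each irreducible sequence has at least one item,
so its term carries a factor `u`, which improves a congruence modulo `X^k` by one power. -/
theorem irreducible_equation_unique {a u x y : PowerSeries ℚ} (hu : X ∣ u)
    (hx : HasSum (fun c : {c // IsIrreducible c} =>
      u ^ numItems c.1 * slotProd (a + x - 1) x c) (x - 1))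
    (hy : HasSum (fun c : {c // IsIrreducible c} =>
      u ^ numItems c.1 * slotProd (a + y - 1) y c) (y - 1)) : x = y := by
  refine eq_of_forall_X_pow_dvd fun k => ?_
  induction k with
  | zero => simp
  | succ k ih =>
    have h := dvd_of_hasSum hx hy (k := k + 1) fun c => ?_
    · simpa using h
    · rw [← mul_sub, pow_succ']
      exact mul_dvd_mul (hu.trans (dvd_pow_self u (by have := c.2.numItems_pos; omega)))
        (slotProd_dvd_sub ih _)

/-! Operation sequences as quarter plane loops. -/

/-- The step that corresponds to an operation. -/
def Op.toStep : Op → Step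
  | .I1 => .E
  | .I2 => .N
  | .O1 => .W
  | .O2 => .S

theorem toStep_bijective : Function.Bijective Op.toStep := by
  constructor
  · intro a b
    cases a <;> cases b <;> simp [Op.toStep]
  · intro s
    cases s
    exacts [⟨.I1, rfl⟩, ⟨.I2, rfl⟩, ⟨.O1, rfl⟩, ⟨.O2, rfl⟩]

theorem endpoint_map_toStep (w : List Op) : endpoint (w.map Op.toStep) =
    ((w.count .I1 : ℤ) - w.count .O1, (w.count .I2 : ℤ) - w.count .O2) := by
  induction w with
  | nil => rfl
  | cons o w ih =>
    have h : endpoint ((o :: w).map Op.toStep) = o.toStep.vec + endpoint (w.map Op.toStep) := by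
      simp [endpoint]
    rw [h, ih]
    cases o <;> ext <;> simp [Op.toStep, Step.vec] <;> ring

theorem isQuarterPlaneLoop_map_toStep {w : List Op} :
    IsQuarterPlaneLoop (w.map Op.toStep) ↔ OS w := by
  have h1 : endpoint (w.map Op.toStep) = 0 ↔
      w.count .I1 = w.count .O1 ∧ w.count .I2 = w.count .O2 := by
    rw [endpoint_map_toStep, Prod.mk_eq_zero]
    omega
  have h2 : IsQuarterPlaneWalk (w.map Op.toStep) ↔
      ∀ p : List Op, p <+: w → p.count .O1 ≤ p.count .I1 ∧ p.count .O2 ≤ p.count .I2 := by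
    constructor
    · intro h p hp
      have := h _ (hp.map Op.toStep)
      rw [endpoint_map_toStep] at this
      simp only at this
      omega
    · rintro h p ⟨t, ht⟩
      obtain ⟨q, r, rfl, rfl, rfl⟩ := List.map_eq_append_iff.1 ht.symm
      have := h q (List.prefix_append _ _)
      rw [endpoint_map_toStep]
      simp only
      omega
  rw [IsQuarterPlaneLoop, h1, h2, and_comm]
  rfl

theorem corners_map_toStep (w : List Op) : corners (w.map Op.toStep) = cornerCount w := by
  induction w with
  | nil => rfl
  | cons o w ih =>
    rw [cornerCount, ← ih]
    cases w with
    | nil => cases o <;> simp [corners, IsCorner]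
    | cons o' w =>
      have : corners ((o :: o' :: w).map Op.toStep) =
          (if o.toStep = .N ∧ o'.toStep = .W ∨ o.toStep = .E ∧ o'.toStep = .S then 1 else 0) +
            corners ((o' :: w).map Op.toStep) := by
        simp [corners, List.countP_cons, add_comm]
      rw [this]
      congr 1
      cases o <;> cases o' <;> simp [Op.toStep, IsCorner]

theorem sum_weight_eq (A U : PowerSeries ℚ) (n : ℕ) (T : Finset {w // OS w})
    (hT : ∀ w, w ∈ T ↔ numItems w.1 = n) : ∑ w ∈ T, weight A U w =
      Polynomial.aeval A (coeff n loopSeries) * U ^ n := by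
  classical
  rw [loopSeries, coeff_mk, map_sum, Finset.sum_mul]
  have hex : ∀ w : {w // OS w}, w ∈ T → ∃ v : Fin (2 * n) → Step,
      List.ofFn v = w.1.map Op.toStep := by
    intro w hw
    have h : (w.1.map Op.toStep).length = 2 * n := by
      rw [List.length_map, length_of_operationSequence w.2, (hT w).1 hw]
    rw [← h]
    exact ⟨_, List.ofFn_get _⟩
  refine Finset.sum_bij (fun w hw => (hex w hw).choose) ?_ ?_ ?_ ?_
  · intro w hw
    rw [Finset.mem_filter, (hex w hw).choose_spec, isQuarterPlaneLoop_map_toStep]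
    exact ⟨Finset.mem_univ _, w.2⟩
  · intro w hw w' hw' h
    have h1 := (hex w hw).choose_spec
    rw [h, (hex w' hw').choose_spec] at h1
    exact Subtype.ext (List.map_injective_iff.2 toStep_bijective.1 h1.symm)
  · intro v hv
    obtain ⟨w, hw⟩ := List.map_surjective_iff.2 toStep_bijective.2 (List.ofFn v)
    rw [Finset.mem_filter, ← hw, isQuarterPlaneLoop_map_toStep] at hv
    have hmem : (⟨w, hv.2⟩ : {w // OS w}) ∈ T := by
      have h1 := congrArg List.length hw
      rw [List.length_map, length_of_operationSequence hv.2, List.length_ofFn] at h1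
      rw [hT]
      exact Nat.eq_of_mul_eq_mul_left two_pos h1
    exact ⟨⟨w, hv.2⟩, hmem, List.ofFn_injective ((hex _ hmem).choose_spec.trans hw)⟩
  · intro w hw
    rw [(hex w hw).choose_spec, corners_map_toStep, weight, (hT w).1 hw]
    simp

theorem hasSum_loopSeries {A U : PowerSeries ℚ} (hU : X ∣ U) :
    HasSum (fun w : {w // OS w} => weight A U w) (evalSeries loopSeries A U) := by
  classical
  rw [WithPiTopology.hasSum_iff_hasSum_coeff]
  intro m
  have hfin := finite_numItems_le (P := OS) (fun _ h => h) m
  have h1 : HasSum (fun w : {w // OS w} => coeff m (weight A U w))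
      (∑ w ∈ hfin.toFinset, coeff m (weight A U w)) := by
    refine hasSum_sum_of_ne_finset_zero fun w hw => ?_
    -- Because `X ∣ U`, words with more than `m` items do not reach the coefficient of `X^m`; this
    -- justifies the truncation in `evalSeries`.
    have hlt : m < numItems w.1 := by simpa using hw
    exact X_pow_dvd_iff.1 ((pow_dvd_pow_of_dvd hU _).mul_left _) m hlt
  have h2 : coeff m (evalSeries loopSeries A U) =
      ∑ w ∈ hfin.toFinset, coeff m (weight A U w) := by
    rw [evalSeries, coeff_mk, ← Finset.sum_fiberwise_of_maps_to (t := Finset.range (m + 1))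
      (g := fun w : {w // OS w} => numItems w.1)]
    · refine Finset.sum_congr rfl fun n hn => ?_
      rw [← map_sum, ← sum_weight_eq]
      intro w
      simp at hn ⊢
      omega
    · intro w hw
      simp at hw ⊢
      omega
  rw [h2]
  exact h1

/-! The functional equations. -/

theorem constantCoeff_primitiveSeries : constantCoeff primitiveSeries = 0 := by
  rw [← coeff_zero_eq_constantCoeff_apply, primitiveSeries, coeff_mk, card_primitive]
  norm_cast
  rw [Nat.card_eq_zero]
  left
  refine ⟨fun ⟨w, hw, h0⟩ => hw.2.2.1 ?_⟩
  have := length_of_operationSequence hw.1.1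
  rw [h0] at this
  exact List.length_eq_zero_iff.1 this

theorem achievableSeries_mul_one_sub : achievableSeries * (1 - primitiveSeries) = 1 := by
  linear_combination achievableSeries_sub_one

theorem achievableSeries_eq : achievableSeries = (1 - primitiveSeries)⁻¹ := by
  rw [PowerSeries.eq_inv_iff_mul_eq_one (by simp [constantCoeff_primitiveSeries])]
  exact achievableSeries_mul_one_sub

/-- The substitution is chosen so that `(1 + s)S` satisfies the equation that characterises `Q(-s,
u)`. -/
theorem loopEquation_primitiveSeries : LoopEquation primitiveSeries := by
  rw [LoopEquation, ← achievableSeries_eq]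
  set s := primitiveSeries with hs
  set S := achievableSeries with hS
  have hSs : S * (1 - s) = 1 := achievableSeries_mul_one_sub
  have h0 : constantCoeff ((1 + s) ^ 2) ≠ 0 := by simp [hs, constantCoeff_primitiveSeries]
  have hinv := PowerSeries.mul_inv_cancel _ h0
  set v := ((1 + s) ^ 2)⁻¹
  have hu : X ∣ X * v := dvd_mul_right _ _
  refine irreducible_equation_unique hu
    (hasSum_irreducible_all hu (hasSum_loopSeries (A := -s) hu)) ?_
  have e1 : (1 + s) * S - 1 = 2 * (S - 1) := by linear_combination -hSs
  have e2 : -s + (1 + s) * S - 1 = (1 + s) * (S - 1) := by ring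
  rw [e1, e2]
  refine (congrArg (fun g => HasSum g _) (funext fun c => ?_)).mp hasSum_irreducible_both
  -- There are two slots per item, so the slots contribute `(1 + s)²` per item, which cancels
  -- against `v`.
  rw [slotProd_smul, length_of_operationSequence c.2.1, pow_mul, ← mul_assoc, ← mul_pow,
    mul_assoc, mul_comm v, hinv, mul_one]

/-! ### Uniqueness of the solution of the loop equation. -/

/-- One power less of precision suffices for `a`: a non-empty word has an item, hence a factor `u`
divisible by `X`, and the empty word has weight `1` on both sides. -/
theorem weight_dvd_sub {a b u v : PowerSeries ℚ} {k : ℕ} (hu : X ∣ u)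
    (hab : X ^ k ∣ a - b) (huv : X ^ (k + 1) ∣ u - v) {w : List Op} (hw : OS w) :
    X ^ (k + 1) ∣ weight a u w - weight b v w := by
  rcases Nat.eq_zero_or_pos (numItems w) with h0 | h0
  · have := length_of_operationSequence hw
    rw [h0] at this
    rw [List.length_eq_zero_iff.1 this, weight_nil, weight_nil, sub_self]
    exact dvd_zero _
  · rw [weight, weight, show a ^ cornerCount w * u ^ numItems w - b ^ cornerCount w * v ^ numItems w
      = (a ^ cornerCount w - b ^ cornerCount w) * u ^ numItems w +
        b ^ cornerCount w * (u ^ numItems w - v ^ numItems w) by ring]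
    refine dvd_add ?_ ((huv.trans (sub_dvd_pow_sub_pow _ _ _)).mul_left _)
    rw [pow_succ]
    exact mul_dvd_mul (hab.trans (sub_dvd_pow_sub_pow _ _ _)) (hu.trans (dvd_pow_self u h0.ne'))

theorem LoopEquation.unique {F G : PowerSeries ℚ} (hF : LoopEquation F) (hG : LoopEquation G)
    (hF1 : constantCoeff F ≠ 1) (hF2 : constantCoeff F ≠ -1) (hG1 : constantCoeff G ≠ 1)
    (hG2 : constantCoeff G ≠ -1) : F = G := by
  -- The inverse of a power series with zero constant term is `0` by convention; the conditions on
  -- the constant terms make the inverses genuine.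
  have hsub : ∀ {H : PowerSeries ℚ}, constantCoeff H ≠ 1 → (1 - H) * (1 - H)⁻¹ = 1 := fun h =>
    PowerSeries.mul_inv_cancel _ (by simpa [sub_eq_zero] using h.symm)
  have hadd : ∀ {H : PowerSeries ℚ}, constantCoeff H ≠ -1 →
      (1 + H) ^ 2 * ((1 + H) ^ 2)⁻¹ = 1 := by
    intro H h
    refine PowerSeries.mul_inv_cancel _ ?_
    rw [map_pow, map_add, map_one]
    exact pow_ne_zero 2 fun h' => h (by linear_combination h')
  have f1 := hsub hF1
  have g1 := hsub hG1
  have f2 := hadd hF2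
  have g2 := hadd hG2
  rw [LoopEquation] at hF hG
  refine eq_of_forall_X_pow_dvd fun k => ?_
  induction k with
  | zero => simp
  | succ k ih =>
    have hUF : (X : PowerSeries ℚ) ∣ X * ((1 + F) ^ 2)⁻¹ := dvd_mul_right _ _
    have hUG : (X : PowerSeries ℚ) ∣ X * ((1 + G) ^ 2)⁻¹ := dvd_mul_right _ _
    have hUU : X ^ (k + 1) ∣ X * ((1 + F) ^ 2)⁻¹ - X * ((1 + G) ^ 2)⁻¹ := by
      have e : X * ((1 + F) ^ 2)⁻¹ - X * ((1 + G) ^ 2)⁻¹ =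
          (F - G) * X * (-(2 + F + G) * ((1 + F) ^ 2)⁻¹ * ((1 + G) ^ 2)⁻¹) := by
        linear_combination X * ((1 + G) ^ 2)⁻¹ * f2 - X * ((1 + F) ^ 2)⁻¹ * g2
      rw [e, pow_succ]
      exact (mul_dvd_mul ih dvd_rfl).mul_right _
    have hneg : X ^ k ∣ -F - -G := by
      rw [show -F - -G = -(F - G) by ring]
      exact (dvd_neg).2 ih
    have h := dvd_of_hasSum (hasSum_loopSeries hUF) (hasSum_loopSeries hUG)
      fun w => weight_dvd_sub hUF hneg hUU w.2
    rw [hF, hG] at h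
    -- The difference of the two quotients is `2(F - G) / ((1 - F)(1 - G))`, so the congruence for
    -- the quotients passes to `F` and `G`.
    have e : F - G = ((1 + F) * (1 - F)⁻¹ - (1 + G) * (1 - G)⁻¹) *
        ((1 - F) * (1 - G) * C (1 / 2 : ℚ)) := by
      have h2 : (2 : PowerSeries ℚ) * C (1 / 2 : ℚ) = 1 := by
        rw [show (2 : PowerSeries ℚ) = C (2 : ℚ) from (map_ofNat C 2).symm, ← map_mul]
        norm_num
      linear_combination (-(F - G)) * h2 - (1 + F) * (1 - G) * C (1 / 2 : ℚ) * f1 +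
        (1 + G) * (1 - F) * C (1 / 2 : ℚ) * g1
    rw [e]
    exact h.mul_right _

end TwoStacks

end

theorem mainTheorem3 :
    PowerSeries.constantCoeff TwoStacks.primitiveSeries = 0 ∧
    TwoStacks.achievableSeries = (1 - TwoStacks.primitiveSeries)⁻¹ ∧
    TwoStacks.evalSeries TwoStacks.loopSeries (-TwoStacks.primitiveSeries)
        (PowerSeries.X * ((1 + TwoStacks.primitiveSeries) ^ 2)⁻¹) =
      (1 + TwoStacks.primitiveSeries) * (1 - TwoStacks.primitiveSeries)⁻¹ ∧
    (∀ F : PowerSeries ℚ,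
      PowerSeries.constantCoeff F ≠ 1 → PowerSeries.constantCoeff F ≠ -1 →
      TwoStacks.LoopEquation F → F = TwoStacks.primitiveSeries) ∧
    (∀ F G : PowerSeries ℚ,
      PowerSeries.constantCoeff F ≠ 1 → PowerSeries.constantCoeff F ≠ -1 →
      TwoStacks.LoopEquation F → G = (1 - F)⁻¹ → G = TwoStacks.achievableSeries) := by
  have huniq : ∀ F : PowerSeries ℚ,
      PowerSeries.constantCoeff F ≠ 1 → PowerSeries.constantCoeff F ≠ -1 →
      TwoStacks.LoopEquation F → F = TwoStacks.primitiveSeries := fun F h1 h2 hF =>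
    hF.unique TwoStacks.loopEquation_primitiveSeries h1 h2
      (by simp [TwoStacks.constantCoeff_primitiveSeries])
      (by simp [TwoStacks.constantCoeff_primitiveSeries])
  refine ⟨TwoStacks.constantCoeff_primitiveSeries, TwoStacks.achievableSeries_eq,
    TwoStacks.loopEquation_primitiveSeries, huniq, fun F G h1 h2 hF hG => ?_⟩
  rw [hG, huniq F h1 h2 hF, TwoStacks.achievableSeries_eq]
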